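/- Let $SO(2,\mathbb C)=\{\mathrm{diag}(z,z^{-1}) : z\in\mathbb C^\times\}$ act on $\mathfrak{sl}_2(\mathbb C)$ by conjugation, and let $j_0:\mathrm{Lie}(SO(2,\mathbb C))\hookrightarrow\mathfrak{sl}_2(\mathbb C)$ be the inclusion of the diagonal matrices. For a commutative $\mathbb C$-algebra $R$, an algebraic family of Harish-Chandra pairs over $\boldsymbol X=\mathrm{Spec}\,R$ with constant family of groups $\boldsymbol K=\boldsymbol X\times K$, where $K$ is a (linear) complex algebraic group, consists of a locally free $R$-module $\boldsymbol{\mathfrak g}$ of finite rank with an $R$-bilinear Lie bracket, an algebraic action $\alpha$ of $K$ on $\boldsymbol{\mathfrak g}$ by automorphisms of Lie algebras over $R$, and a $K$-equivariant morphism of complex Lie algebras $j:\mathrm{Lie}(K)\to\boldsymbol{\mathfrak g}$ with $[j(Z),Y]=d\alpha(Z)Y$ for all $Z\in\mathrm{Lie}(K)$, $Y\in\boldsymbol{\mathfrak g}$. Two such families $(\boldsymbol{\mathfrak g}_1,K_1)$ and $(\boldsymbol{\mathfrak g}_2,K_2)$ are isomorphic if there are an isomorphism $\psi:\boldsymbol{\mathfrak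 g}_1\to\boldsymbol{\mathfrak g}_2$ of Lie algebras over $R$ and an isomorphism $\psi_K:K_1\to K_2$ of complex algebraic groups with $\psi(\alpha_1(k)X)=\alpha_2(\psi_K(k))\psi(X)$ and $\psi(j_1(Z))=j_2(d\psi_K(Z))$ for all $k\in K_1$, $X\in\boldsymbol{\mathfrak g}_1$, $Z\in\mathrm{Lie}(K_1)$. Such a family over $\mathbb A^1=\mathrm{Spec}\,\mathbb C[x]$ is called an extension of $(\mathfrak{sl}_2(\mathbb C),SO(2,\mathbb C))/\mathbb C^\times$ if its restriction to $\mathbb C^\times=\mathrm{Spec}\,\mathbb C[x,x^{-1}]$ is isomorphic to the constant family $(\mathbb C[x,x^{-1}]\otimes_{\mathbb C}\mathfrak{sl}_2(\mathbb C),SO(2,\mathbb C))$. **Corollary (integrability of extensions).** Let $(\boldsymbol{\mathfrak g},\boldsymbol K)$ be an extension of $(\mathfrak{sl}_2(\mathbb C),SO(2,\mathbb C))/\mathbb C^\times$ over $\mathbb A^1$. Then there is an algebraic family $\boldsymbol G$ of complex algebraic groups over $\mathbb A^1$ that contains $\boldsymbol K$ and whose family of Lie algebras is $\boldsymbol{\mathfrak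 g}$. Precisely: there are a smooth affine group scheme $\boldsymbol G\to\mathbb A^1$, a homomorphism of group schemes $\iota:\boldsymbol K\to\boldsymbol G$ over $\mathbb A^1$ that is a closed immersion, and an isomorphism $\varphi:\mathrm{Lie}(\boldsymbol G)\to\boldsymbol{\mathfrak g}$ of Lie algebras over $\mathbb C[x]$ such that $\varphi(d\iota(Z))=j(Z)$ for all $Z\in\mathrm{Lie}(K)$ and $\varphi(\mathrm{Ad}(\iota(k))W)=\alpha(k)\varphi(W)$ for all $k\in K$, $W\in\mathrm{Lie}(\boldsymbol G)$. -/

import Mathlib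

open scoped TensorProduct Polynomial LaurentPolynomial

noncomputable section

/-! ### The Lie algebra of an affine group scheme

An affine group scheme `G = Spec B` over `Spec R` is given by its commutative Hopf algebra `B`. -/

namespace GroupFamily

section LieAlgebra

variable (R : Type*) (B : Type*) [CommRing R] [CommRing B] [HopfAlgebra R B]

/-- `Lie(G)` for `G = Spec B`: the left invariant `R`-derivations of `B`, that is, the derivations
`D` with `Δ ∘ D = (id ⊗ D) ∘ Δ`, with the commutator as bracket. -/
def lie : LieSubalgebra R (Derivation R B B) where
  carrier := {D | ∀ b, Coalgebra.comul (R := R) (D b) =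
    (D : B →ₗ[R] B).lTensor B (Coalgebra.comul (R := R) b)}
  zero_mem' := by intro b; simp
  add_mem' := by
    intro D E hD hE b
    simp only [Set.mem_ofPred_eq] at hD hE
    simp [hD, hE, LinearMap.lTensor_add]
  smul_mem' := by
    intro r D hD b
    simp only [Set.mem_ofPred_eq] at hD
    simp [hD, LinearMap.lTensor_smul]
  lie_mem' := by
    intro D E hD hE b
    have key : ∀ F G : Derivation R B B,
        (∀ b, Coalgebra.comul (R := R) (F b) =
          (F : B →ₗ[R] B).lTensor B (Coalgebra.comul (R := R) b)) →
        (∀ b, Coalgebra.comul (R := R) (G b) =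
          (G : B →ₗ[R] B).lTensor B (Coalgebra.comul (R := R) b)) →
        Coalgebra.comul (R := R) (F (G b)) =
          ((F : B →ₗ[R] B) ∘ₗ (G : B →ₗ[R] B)).lTensor B (Coalgebra.comul (R := R) b) := by
      intro F G hF hG
      rw [hF, hG, LinearMap.lTensor_comp]; rfl
    have h : ((⁅D, E⁆ : Derivation R B B) : B →ₗ[R] B) =
        (D : B →ₗ[R] B) ∘ₗ (E : B →ₗ[R] B) - (E : B →ₗ[R] B) ∘ₗ (D : B →ₗ[R] B) := by
      ext x; exact Derivation.commutator_apply (D1 := D) (D2 := E) (a := x)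
    rw [h, LinearMap.lTensor_sub, LinearMap.sub_apply, ← key D E hD hE, ← key E D hE hD,
      Derivation.commutator_apply, map_sub]

variable {R B}

/-- The tangent vector at the identity section determined by an element of `Lie(G)`. -/
def atOne : lie R B →ₗ[R] (B →ₗ[R] R) where
  toFun D := Coalgebra.counit (R := R) ∘ₗ (D.1 : B →ₗ[R] B)
  map_add' D E := by ext; simp
  map_smul' r D := by ext; simp

@[simp] theorem atOne_apply (D : lie R B) (b : B) :
    atOne D b = Coalgebra.counit (R := R) (D.1 b) := rfl

/-- A tangent vector at the identity section: a linear functional that satisfies the product rule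
at the counit. -/
def IsTangentVector (v : B →ₗ[R] R) : Prop :=
  ∀ a b, v (a * b) = Coalgebra.counit (R := R) a * v b + Coalgebra.counit (R := R) b * v a

theorem isTangentVector_atOne (D : lie R B) : IsTangentVector (atOne D) := by
  intro a b
  simp [Bialgebra.counit_mul]

/-- `b ↦ ∑ b₍₁₎ v(b₍₂₎)`. -/
def convRight (v : B →ₗ[R] R) : B →ₗ[R] B :=
  (TensorProduct.rid R B).toLinearMap ∘ₗ v.lTensor B ∘ₗ Coalgebra.comul (R := R)

theorem convRight_atOne (D : lie R B) (b : B) : convRight (atOne D) b = D.1 b := by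
  have h := D.2 b
  have h2 := congrArg ((Coalgebra.counit (R := R) (A := B)).lTensor B) h
  rw [Coalgebra.lTensor_counit_comul, ← LinearMap.comp_apply, ← LinearMap.lTensor_comp] at h2
  simp only [convRight, LinearMap.comp_apply, LinearEquiv.coe_coe]
  change TensorProduct.rid R B ((Coalgebra.counit (R := R) ∘ₗ (D.1 : B →ₗ[R] B)).lTensor B _) = _
  rw [← h2]; simp

/-- The left invariant derivation with a prescribed tangent vector at the identity section. -/
def ofTangentVector (v : B →ₗ[R] R) (hv : IsTangentVector v) : lie R B :=
  ⟨Derivation.mk' (convRight v) (by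
    have hE : ∀ a : B, TensorProduct.rid R B
        ((Coalgebra.counit (R := R) (A := B)).lTensor B (Coalgebra.comul (R := R) a)) = a := by
      intro a; rw [Coalgebra.lTensor_counit_comul]; simp
    have key : ∀ x y : B ⊗[R] B, TensorProduct.rid R B (v.lTensor B (x * y)) =
        TensorProduct.rid R B ((Coalgebra.counit (R := R) (A := B)).lTensor B x) *
            TensorProduct.rid R B (v.lTensor B y) +
          TensorProduct.rid R B ((Coalgebra.counit (R := R) (A := B)).lTensor B y) *
            TensorProduct.rid R B (v.lTensor B x) := by
      intro x y
      induction x with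
      | zero => simp
      | add x₁ x₂ h₁ h₂ => rw [add_mul, map_add, map_add, h₁, h₂]; simp only [map_add]; ring
      | tmul a b =>
        induction y with
        | zero => simp
        | add y₁ y₂ h₁ h₂ => rw [mul_add, map_add, map_add, h₁, h₂]; simp only [map_add]; ring
        | tmul c d =>
          simp only [Algebra.TensorProduct.tmul_mul_tmul, LinearMap.lTensor_tmul,
            TensorProduct.rid_tmul, hv b d, Algebra.smul_def, map_add, map_mul]
          ring
    intro a b
    have := key (Coalgebra.comul (R := R) a) (Coalgebra.comul (R := R) b)
    rw [hE, hE] at this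
    simpa [convRight, Bialgebra.comul_mul] using this), by
    intro b
    change Coalgebra.comul (R := R) (convRight v b) = (convRight v).lTensor B _
    have h1 : ∀ x : B ⊗[R] B, Coalgebra.comul (R := R) (TensorProduct.rid R B (v.lTensor B x)) =
        (TensorProduct.rid R B).toLinearMap.lTensor B ((v.lTensor B).lTensor B
          (TensorProduct.assoc R B B B ((Coalgebra.comul (R := R)).rTensor B x))) := by
      intro x
      induction x with
      | zero => simp
      | add x y hx hy => simp only [map_add, hx, hy]
      | tmul a b =>
        simp only [LinearMap.lTensor_tmul, LinearMap.rTensor_tmul, TensorProduct.rid_tmul, map_smul]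
        generalize Coalgebra.comul (R := R) a = y
        induction y with
        | zero => simp
        | add x y hx hy => simp only [map_add, smul_add, TensorProduct.add_tmul, hx, hy]
        | tmul c d => simp
    simp only [convRight, LinearMap.comp_apply, LinearEquiv.coe_coe, LinearMap.lTensor_comp]
    rw [h1, Coalgebra.coassoc_apply]⟩

@[simp] theorem atOne_ofTangentVector (v : B →ₗ[R] R) (hv : IsTangentVector v) :
    atOne (ofTangentVector v hv) = v := by
  ext b
  change Coalgebra.counit (R := R) (convRight v b) = v b
  have h1 : ∀ x : B ⊗[R] B, Coalgebra.counit (R := R) (TensorProduct.rid R B (v.lTensor B x)) =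
      v (TensorProduct.lid R B ((Coalgebra.counit (R := R)).rTensor B x)) := by
    intro x
    induction x with
    | zero => simp
    | add x y hx hy => simp only [map_add, hx, hy]
    | tmul a b => simp [mul_comm]
  simp only [convRight, LinearMap.comp_apply, LinearEquiv.coe_coe]
  rw [h1, Coalgebra.rTensor_counit_comul]; simp

/-- The comorphism `b ↦ ∑ g(b₍₁₎) b₍₂₎ g(S b₍₃₎)` of the conjugation `h ↦ g h g⁻¹` by a point
`g ∈ G(R)`. -/
def conj (g : B →ₐ[R] R) : B →ₐ[R] B :=
  (WithConv.toConv ((Algebra.ofId R B).comp g) * WithConv.toConv (AlgHom.id R B) *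
    (WithConv.toConv ((Algebra.ofId R B).comp g))⁻¹).ofConv

theorem counit_conj (g : B →ₐ[R] R) (b : B) :
    Coalgebra.counit (R := R) (conj g b) = Coalgebra.counit (R := R) b := by
  have h : (Bialgebra.counitAlgHom R B).comp (conj g) = Bialgebra.counitAlgHom R B := by
    have hg : (Bialgebra.counitAlgHom R B).comp ((Algebra.ofId R B).comp g) = g := by
      ext; simp [Algebra.ofId_apply]
    have hi : (Bialgebra.counitAlgHom R B).comp
        ((WithConv.toConv ((Algebra.ofId R B).comp g))⁻¹).ofConv =
        ((WithConv.toConv g)⁻¹).ofConv := by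
      change (Bialgebra.counitAlgHom R B).comp (((Algebra.ofId R B).comp g).comp _) = g.comp _
      rw [← AlgHom.comp_assoc, hg]
    have h1 : WithConv.toConv ((Bialgebra.counitAlgHom R B).comp (AlgHom.id R B)) = 1 := by
      rw [AlgHom.convOne_def]
      congr 1
    unfold conj
    rw [AlgHom.comp_convMul_distrib, AlgHom.comp_convMul_distrib, hi]
    simp only [WithConv.ofConv_toConv, WithConv.toConv_ofConv, h1, hg, mul_one, mul_inv_cancel]
    rw [AlgHom.convOne_def]
    rfl
  exact DFunLike.congr_fun h b

theorem isTangentVector_conj (g : B →ₐ[R] R) (D : lie R B) :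
    IsTangentVector (atOne D ∘ₗ (conj g).toLinearMap) := by
  intro a b
  simp only [LinearMap.comp_apply, AlgHom.toLinearMap_apply, map_mul,
    isTangentVector_atOne D (conj g a) (conj g b), counit_conj]

/-- The adjoint action of a point `g ∈ G(R)` on `Lie(G)`, the differential at the identity section
of `h ↦ g h g⁻¹`. -/
def Ad (g : B →ₐ[R] R) (D : lie R B) : lie R B :=
  ofTangentVector (atOne D ∘ₗ (conj g).toLinearMap) (isTangentVector_conj g D)

theorem atOne_Ad (g : B →ₐ[R] R) (D : lie R B) (b : B) :
    atOne (Ad g D) b = atOne D (conj g b) :=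
  LinearMap.congr_fun (atOne_ofTangentVector _ (isTangentVector_conj g D)) b

section Differential

variable {A : Type*} [CommRing A] [HopfAlgebra R A]

theorem isTangentVector_comp (f : B →ₐc[R] A) (D : lie R A) :
    IsTangentVector (atOne D ∘ₗ (f : B →ₐ[R] A).toLinearMap) := by
  intro a b
  have h : ∀ b, Coalgebra.counit (R := R) (f b) = Coalgebra.counit (R := R) b :=
    fun b => CoalgHomClass.counit_comp_apply f b
  simp only [LinearMap.comp_apply, AlgHom.toLinearMap_apply, BialgHom.coe_toAlgHom, map_mul,
    isTangentVector_atOne D (f a) (f b), h]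

/-- The differential `Lie(G) → Lie(H)` of the homomorphism `G = Spec A → H = Spec B` with
comorphism `f`. -/
def differential (f : B →ₐc[R] A) (D : lie R A) : lie R B :=
  ofTangentVector (atOne D ∘ₗ (f : B →ₐ[R] A).toLinearMap) (isTangentVector_comp f D)

theorem atOne_differential (f : B →ₐc[R] A) (D : lie R A) (b : B) :
    atOne (differential f D) b = atOne D (f b) :=
  LinearMap.congr_fun (atOne_ofTangentVector _ (isTangentVector_comp f D)) b

end Differential

end LieAlgebra

section Constant

variable (R : Type*) {A : Type*} [CommRing R] [Algebra ℂ R] [CommRing A] [HopfAlgebra ℂ A]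

theorem isTangentVector_baseChange (Z : lie ℂ A) : IsTangentVector
    ((TensorProduct.AlgebraTensorModule.rid ℂ R R).toLinearMap ∘ₗ (atOne Z).baseChange R) := by
  intro x y
  induction x with
  | zero => simp
  | add x₁ x₂ h₁ h₂ => rw [add_mul, map_add, h₁, h₂]; simp only [map_add]; ring
  | tmul a b =>
    induction y with
    | zero => simp
    | add y₁ y₂ h₁ h₂ => rw [mul_add, map_add, h₁, h₂]; simp only [map_add]; ring
    | tmul c d =>
      have := isTangentVector_atOne Z b d
      simp only [Algebra.TensorProduct.tmul_mul_tmul, LinearMap.comp_apply,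
        LinearMap.baseChange_tmul, LinearEquiv.coe_coe, this,
        TensorProduct.AlgebraTensorModule.rid_tmul, TensorProduct.counit_tmul,
        CommSemiring.counit_apply, Algebra.smul_def, map_add, map_mul]
      ring

/-- The section of `Lie(X × K)` over `X = Spec R` that is constant equal to `Z ∈ Lie(K)`, where
`K = Spec A` and `X × K = Spec (R ⊗ A)`. -/
def constSection (Z : lie ℂ A) : lie R (R ⊗[ℂ] A) :=
  ofTangentVector _ (isTangentVector_baseChange R Z)

theorem atOne_constSection (Z : lie ℂ A) (r : R) (a : A) :
    atOne (constSection R Z) (r ⊗ₜ a) = atOne Z a • r := by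
  refine (LinearMap.congr_fun (atOne_ofTangentVector _ (isTangentVector_baseChange R Z)) _).trans ?_
  simp

/-- The constant section of `X × K → X` with value `k ∈ K(ℂ)`. -/
def constPoint (k : A →ₐ[ℂ] ℂ) : R ⊗[ℂ] A →ₐ[R] R :=
  Algebra.TensorProduct.lift (AlgHom.id R R) ((Algebra.ofId ℂ R).comp k) fun _ _ => .all _ _

end Constant

end GroupFamily

/-! ### Algebraic families of Harish-Chandra pairs over an affine base -/

section Pairs

variable {R : Type*} {A : Type*} {𝔤 : Type*} [CommRing R] [Algebra ℂ R] [CommRing A]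
  [HopfAlgebra ℂ A] [LieRing 𝔤] [LieAlgebra R 𝔤] [Module ℂ 𝔤] [IsScalarTower ℂ R 𝔤]

/-- `x ↦ ∑ v(x₍₁₎) x₍₀₎` for a coaction `ρ x = ∑ x₍₀₎ ⊗ x₍₁₎`. For a point `v = k ∈ K(ℂ)` this is
the action `α(k)` of `k`, for a tangent vector `v = Z ∈ Lie(K)` it is the differential `dα(Z)`. -/
def contract (ρ : 𝔤 →ₗ[R] 𝔤 ⊗[ℂ] A) (v : A →ₗ[ℂ] ℂ) : 𝔤 →ₗ[R] 𝔤 :=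
  (TensorProduct.AlgebraTensorModule.rid ℂ R 𝔤).toLinearMap ∘ₗ
    TensorProduct.AlgebraTensorModule.lTensor R 𝔤 v ∘ₗ ρ

variable (R A 𝔤) in
/-- An algebraic family of Harish-Chandra pairs over `X = Spec R` whose family of groups is the
constant family `X × K`, `K = Spec A` a complex algebraic group, described by global sections:
a locally free `R`-module `𝔤` of finite rank with a Lie bracket over `R`, an algebraic action `α`
of `K` on `𝔤` by automorphisms of Lie algebras over `R` (a coaction of `A`), and a `K`-equivariant
morphism of complex Lie algebras `j : Lie(K) → 𝔤` such that `[j Z, Y] = dα(Z) Y`. -/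
structure HarishChandraPair where
  group_smooth : Algebra.Smooth ℂ A
  finite : Module.Finite R 𝔤
  projective : Module.Projective R 𝔤
  coact : 𝔤 →ₗ[R] 𝔤 ⊗[ℂ] A
  coact_counit : ∀ x, TensorProduct.rid ℂ 𝔤
    ((Coalgebra.counit (R := ℂ) (A := A)).lTensor 𝔤 (coact x)) = x
  coact_coassoc : ∀ x, TensorProduct.assoc ℂ 𝔤 A A ((coact.restrictScalars ℂ).rTensor A (coact x)) =
    (Coalgebra.comul (R := ℂ) (A := A)).lTensor 𝔤 (coact x)
  act_lie : ∀ (k : A →ₐ[ℂ] ℂ) (x y : 𝔤), contract coact k.toLinearMap ⁅x, y⁆ =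
    ⁅contract coact k.toLinearMap x, contract coact k.toLinearMap y⁆
  j : GroupFamily.lie ℂ A →ₗ[ℂ] 𝔤
  j_lie : ∀ Z W, j ⁅Z, W⁆ = ⁅j Z, j W⁆
  j_equivariant : ∀ (k : A →ₐ[ℂ] ℂ) Z,
    j (GroupFamily.Ad k Z) = contract coact k.toLinearMap (j Z)
  lie_j : ∀ Z y, ⁅j Z, y⁆ = contract coact (GroupFamily.atOne Z) y

namespace HarishChandraPair

/-- The action `α(k)` of `k ∈ K(ℂ)` on `𝔤`. -/
def act (P : HarishChandraPair R A 𝔤) (k : A →ₐ[ℂ] ℂ) : 𝔤 →ₗ[R] 𝔤 :=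
  contract P.coact k.toLinearMap

/-- An isomorphism of pairs: an isomorphism of Lie algebras over `R` and an isomorphism
`ψ : K₁ → K₂` of complex algebraic groups, given by its comorphism, that satisfy twisted
equivariance and compatibility with the embeddings. -/
structure Iso {A₁ A₂ 𝔤₁ 𝔤₂ : Type*} [CommRing A₁] [HopfAlgebra ℂ A₁] [CommRing A₂]
    [HopfAlgebra ℂ A₂] [LieRing 𝔤₁] [LieAlgebra R 𝔤₁] [Module ℂ 𝔤₁] [IsScalarTower ℂ R 𝔤₁]
    [LieRing 𝔤₂] [LieAlgebra R 𝔤₂] [Module ℂ 𝔤₂] [IsScalarTower ℂ R 𝔤₂]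
    (P : HarishChandraPair R A₁ 𝔤₁) (Q : HarishChandraPair R A₂ 𝔤₂) where
  lieEquiv : 𝔤₁ ≃ₗ⁅R⁆ 𝔤₂
  groupEquiv : A₂ ≃ₐc[ℂ] A₁
  equivariant : ∀ (k : A₁ →ₐ[ℂ] ℂ) (x : 𝔤₁), lieEquiv (P.act k x) =
    Q.act (k.comp ((groupEquiv : A₂ →ₐc[ℂ] A₁) : A₂ →ₐ[ℂ] A₁)) (lieEquiv x)
  compatible : ∀ Z : GroupFamily.lie ℂ A₁, lieEquiv (P.j Z) =
    Q.j (GroupFamily.differential (groupEquiv : A₂ →ₐc[ℂ] A₁) Z)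

section BaseChange

variable (R' : Type*) [CommRing R'] [Algebra ℂ R'] [Algebra R R'] [IsScalarTower ℂ R R']

/-- The coaction on the base change `R' ⊗ 𝔤`: the `R'`-linear extension of the coaction on `𝔤`. -/
def baseChangeCoact (ρ : 𝔤 →ₗ[R] 𝔤 ⊗[ℂ] A) : R' ⊗[R] 𝔤 →ₗ[R'] (R' ⊗[R] 𝔤) ⊗[ℂ] A :=
  (TensorProduct.AlgebraTensorModule.assoc ℂ R R' R' 𝔤 A).symm.toLinearMap ∘ₗ ρ.baseChange R'

theorem contract_baseChangeCoact (ρ : 𝔤 →ₗ[R] 𝔤 ⊗[ℂ] A) (v : A →ₗ[ℂ] ℂ) (r : R') (x : 𝔤) :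
    contract (baseChangeCoact R' ρ) v (r ⊗ₜ x) = r ⊗ₜ contract ρ v x := by
  simp only [contract, baseChangeCoact, LinearMap.comp_apply, LinearEquiv.coe_coe,
    LinearMap.baseChange_tmul]
  generalize ρ x = y
  induction y with
  | zero => simp
  | add y z hy hz => simp only [TensorProduct.tmul_add, map_add, hy, hz]
  | tmul y a => simp

/-- The pullback of a pair along `Spec R' → Spec R`; for an open `Spec R'` the restriction. -/
def baseChange (P : HarishChandraPair R A 𝔤) : HarishChandraPair R' A (R' ⊗[R] 𝔤) where
  group_smooth := P.group_smooth
  finite := by have := P.finite; infer_instance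
  projective := by have := P.projective; infer_instance
  coact := baseChangeCoact R' P.coact
  coact_counit x := by
    induction x with
    | zero => simp
    | add x y hx hy => simp only [map_add, hx, hy]
    | tmul r x =>
      have h := contract_baseChangeCoact R' P.coact (Coalgebra.counit (R := ℂ) (A := A)) r x
      have h' : contract P.coact (Coalgebra.counit (R := ℂ) (A := A)) x = x := P.coact_counit x
      rw [h'] at h
      exact h
  coact_coassoc x := by
    induction x with
    | zero => simp
    | add x y hx hy => simp only [map_add, hx, hy]
    | tmul r x =>
      let L : 𝔤 ⊗[ℂ] (A ⊗[ℂ] A) →ₗ[ℂ] (R' ⊗[R] 𝔤) ⊗[ℂ] (A ⊗[ℂ] A) :=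
        ((TensorProduct.mk R R' 𝔤 r).restrictScalars ℂ).rTensor (A ⊗[ℂ] A)
      have hs : ∀ y : 𝔤 ⊗[ℂ] A,
          (TensorProduct.AlgebraTensorModule.assoc ℂ R R' R' 𝔤 A).symm (r ⊗ₜ y) =
            ((TensorProduct.mk R R' 𝔤 r).restrictScalars ℂ).rTensor A y := by
        intro y
        induction y with
        | zero => simp
        | add y z hy hz => simp only [TensorProduct.tmul_add, map_add, hy, hz]
        | tmul y a => simp
      have h1 : baseChangeCoact R' P.coact (r ⊗ₜ x) =
          ((TensorProduct.mk R R' 𝔤 r).restrictScalars ℂ).rTensor A (P.coact x) := by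
        simp [baseChangeCoact, hs]
      have h := congrArg L (P.coact_coassoc x)
      rw [h1]
      trans L (TensorProduct.assoc ℂ 𝔤 A A
        ((P.coact.restrictScalars ℂ).rTensor A (P.coact x)))
      · generalize P.coact x = y
        induction y with
        | zero => simp
        | add y z hy hz => simp only [map_add, hy, hz]
        | tmul y a =>
          simp only [LinearMap.rTensor_tmul, LinearMap.restrictScalars_apply,
            TensorProduct.mk_apply, baseChangeCoact, LinearMap.comp_apply, LinearEquiv.coe_coe,
            LinearMap.baseChange_tmul, hs]
          generalize P.coact y = z
          induction z with
          | zero => simp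
          | add y z hy hz => simp only [TensorProduct.add_tmul, map_add, hy, hz]
          | tmul y b => simp [L]
      · rw [h]
        generalize P.coact x = y
        induction y with
        | zero => simp
        | add y z hy hz => simp only [map_add, hy, hz]
        | tmul y a => simp [L]
  act_lie k x y := by
    induction x with
    | zero => simp
    | add x₁ x₂ h₁ h₂ => simp only [add_lie, map_add, h₁, h₂]
    | tmul r x =>
      induction y with
      | zero => simp
      | add y₁ y₂ h₁ h₂ => simp only [lie_add, map_add, h₁, h₂]
      | tmul s y =>
        simp only [LieAlgebra.ExtendScalars.bracket_tmul, contract_baseChangeCoact, P.act_lie]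
  j := ((TensorProduct.mk R R' 𝔤 1).restrictScalars ℂ) ∘ₗ P.j
  j_lie Z W := by
    simp [P.j_lie]
  j_equivariant k Z := by
    simp [P.j_equivariant, contract_baseChangeCoact]
  lie_j Z y := by
    induction y with
    | zero => simp
    | add y₁ y₂ h₁ h₂ => simp only [lie_add, map_add, h₁, h₂]
    | tmul s y => simp [contract_baseChangeCoact, P.lie_j]

end BaseChange

/-- Data exhibiting the smooth affine group scheme `G = Spec B → Spec R` as an algebraic family of
complex algebraic groups that contains the constant family `X × K` (through the closed immersion
of group schemes with comorphism `incl`) and whose family of Lie algebras `Lie(G)` is `𝔤`, with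
`j : Lie(K) → 𝔤` the differential of the inclusion and the action of `K` on `𝔤` the
adjoint action. -/
structure Integration (P : HarishChandraPair R A 𝔤) (B : Type*) [CommRing B]
    [HopfAlgebra R B] where
  smooth : Algebra.Smooth R B
  incl : B →ₐc[R] R ⊗[ℂ] A
  incl_surjective : Function.Surjective incl
  lieEquiv : GroupFamily.lie R B ≃ₗ⁅R⁆ 𝔤
  lieEquiv_differential : ∀ Z : GroupFamily.lie ℂ A,
    lieEquiv (GroupFamily.differential incl (GroupFamily.constSection R Z)) = P.j Z
  lieEquiv_Ad : ∀ (k : A →ₐ[ℂ] ℂ) (D : GroupFamily.lie R B),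
    lieEquiv (GroupFamily.Ad ((GroupFamily.constPoint R k).comp (incl : B →ₐ[R] R ⊗[ℂ] A)) D) =
      P.act k (lieEquiv D)

end HarishChandraPair

end Pairs

/-! ### The pair `(𝔰𝔩₂(ℂ), SO(2, ℂ))` and its extensions over the affine line -/

section SL2

open LaurentPolynomial

/-- `𝔰𝔩₂(ℂ)`, the trace zero matrices. -/
abbrev sl2 : Type := LieAlgebra.SpecialLinear.sl (Fin 2) ℂ

/-- The coordinate ring of `SO(2, ℂ)`, realized as the group of the matrices
`k(z) = diag(z, z⁻¹)`, `z ∈ ℂˣ`; the variable `T` is the coordinate function `z`. -/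
abbrev SO2Ring : Type := ℂ[T;T⁻¹]

/-- `ℂˣ → 𝔸¹` is a morphism over `Spec ℂ`. -/
instance : IsScalarTower ℂ ℂ[X] ℂ[T;T⁻¹] :=
  IsScalarTower.of_algebraMap_eq fun z => (Polynomial.toLaurent_C z).symm

def sl2h : sl2 := ⟨!![1, 0; 0, -1], by simp [LieAlgebra.SpecialLinear.sl, Matrix.trace_fin_two]⟩
def sl2e : sl2 := ⟨!![0, 1; 0, 0], by simp [LieAlgebra.SpecialLinear.sl, Matrix.trace_fin_two]⟩
def sl2f : sl2 := ⟨!![0, 0; 1, 0], by simp [LieAlgebra.SpecialLinear.sl, Matrix.trace_fin_two]⟩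

theorem sl2_trace (M : sl2) : M.1 0 0 + M.1 1 1 = 0 := by
  have h : Matrix.trace M.1 = 0 := M.2
  rwa [Matrix.trace_fin_two] at h

theorem sl2_eq (M : sl2) : M = M.1 0 0 • sl2h + M.1 0 1 • sl2e + M.1 1 0 • sl2f := by
  have h := sl2_trace M
  apply Subtype.ext
  ext i j
  change M.1 i j = (M.1 0 0 • sl2h.1 + M.1 0 1 • sl2e.1 + M.1 1 0 • sl2f.1) i j
  fin_cases i <;> fin_cases j <;> simp [sl2h, sl2e, sl2f]
  linear_combination h

/-- The action of `SO(2, ℂ)` on `𝔰𝔩₂(ℂ)` by conjugation: the weights of `sl2h`, `sl2e`, `sl2f` are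
`0`, `2`, `-2`. -/
def sl2Coact : sl2 →ₗ[ℂ] sl2 ⊗[ℂ] SO2Ring where
  toFun M := M.1 0 0 • (sl2h ⊗ₜ T 0) + M.1 0 1 • (sl2e ⊗ₜ T 2) + M.1 1 0 • (sl2f ⊗ₜ T (-2))
  map_add' M N := by
    change (M.1 0 0 + N.1 0 0) • _ + (M.1 0 1 + N.1 0 1) • _ + (M.1 1 0 + N.1 1 0) • _ = _
    simp only [add_smul]; abel
  map_smul' c M := by
    change (c * M.1 0 0) • _ + (c * M.1 0 1) • _ + (c * M.1 1 0) • _ = _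
    simp [mul_smul, smul_add]

theorem sl2Coact_h : sl2Coact sl2h = sl2h ⊗ₜ T 0 := by simp [sl2Coact, sl2h]
theorem sl2Coact_e : sl2Coact sl2e = sl2e ⊗ₜ T 2 := by simp [sl2Coact, sl2e]
theorem sl2Coact_f : sl2Coact sl2f = sl2f ⊗ₜ T (-2) := by simp [sl2Coact, sl2f]

theorem contract_sl2Coact (v : SO2Ring →ₗ[ℂ] ℂ) (M : sl2) : contract sl2Coact v M =
    (M.1 0 0 * v (T 0)) • sl2h + (M.1 0 1 * v (T 2)) • sl2e + (M.1 1 0 * v (T (-2))) • sl2f := by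
  simp [contract, sl2Coact, mul_smul]

/-- The action of `k(z)` is conjugation by `k(z) = diag(z, z⁻¹)`. -/
theorem contract_sl2Coact_point (k : SO2Ring →ₐ[ℂ] ℂ) (M : sl2) :
    (contract sl2Coact k.toLinearMap M).1 =
      !![k (T 1), 0; 0, k (T (-1))] * M.1 * !![k (T (-1)), 0; 0, k (T 1)] := by
  have h1 : k (T 1) * k (T (-1)) = 1 := by rw [← map_mul, ← T_add]; simp
  have h2 : k (T 2) = k (T 1) * k (T 1) := by rw [← map_mul, ← T_add]; rfl
  have h3 : k (T (-2)) = k (T (-1)) * k (T (-1)) := by rw [← map_mul, ← T_add]; rfl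
  have h := sl2_trace M
  rw [contract_sl2Coact]
  change (M.1 0 0 * k (T 0)) • sl2h.1 + (M.1 0 1 * k (T 2)) • sl2e.1 +
    (M.1 1 0 * k (T (-2))) • sl2f.1 = _
  rw [h2, h3]
  ext i j
  fin_cases i <;> fin_cases j <;> simp [sl2h, sl2e, sl2f, Matrix.mul_apply, Matrix.vecMul, dotProduct, Fin.sum_univ_two]
  · linear_combination (-M.1 0 0) * h1
  · ring
  · ring
  · linear_combination (-M.1 1 1) * h1 - h

/-- The identification `Lie(SO(2, ℂ)) = 𝔰𝔬₂(ℂ) = {diag(a, -a)} ⊆ 𝔰𝔩₂(ℂ)`: the tangent vector `Z` at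
the identity goes to the derivative `diag(Z(T), -Z(T))` of `diag(T, T⁻¹)` along `Z`. -/
def sl2j : GroupFamily.lie ℂ SO2Ring →ₗ[ℂ] sl2 where
  toFun Z := GroupFamily.atOne Z (T 1) • sl2h
  map_add' Z W := by simp [add_smul]
  map_smul' c Z := by simp [mul_smul]

theorem so2_apply_T (Z : GroupFamily.lie ℂ SO2Ring) (n : ℤ) :
    Z.1 (T n) = GroupFamily.atOne Z (T n) • T n := by
  rw [← GroupFamily.convRight_atOne]
  simp [GroupFamily.convRight, comul_T]

theorem so2_atOne_T_two (Z : GroupFamily.lie ℂ SO2Ring) :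
    GroupFamily.atOne Z (T 2) = 2 * GroupFamily.atOne Z (T 1) := by
  rw [show (T 2 : SO2Ring) = T 1 * T 1 by rw [← T_add]; rfl,
    GroupFamily.isTangentVector_atOne Z, counit_T]
  ring

theorem so2_atOne_T_zero (Z : GroupFamily.lie ℂ SO2Ring) :
    GroupFamily.atOne Z (T 0) = 0 := by
  simp

theorem so2_atOne_T_neg_two (Z : GroupFamily.lie ℂ SO2Ring) :
    GroupFamily.atOne Z (T (-2)) = -2 * GroupFamily.atOne Z (T 1) := by
  have h := so2_atOne_T_zero Z
  rw [show (T 0 : SO2Ring) = T 2 * T (-2) by rw [← T_add]; rfl,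
    GroupFamily.isTangentVector_atOne Z, counit_T, counit_T, so2_atOne_T_two] at h
  linear_combination h

/-- The Harish-Chandra pair `(𝔰𝔩₂(ℂ), SO(2, ℂ))` of `SL₂(ℝ)`: a family over the point `Spec ℂ`. -/
def sl2Pair : HarishChandraPair ℂ SO2Ring sl2 where
  group_smooth := by
    have := Algebra.Smooth.of_isLocalization_Away (R := ℂ[X]) (A := SO2Ring) Polynomial.X
    have h : Algebra.Smooth ℂ ℂ[X] := ⟨inferInstance, inferInstance⟩
    exact Algebra.Smooth.comp ℂ ℂ[X] SO2Ring
  finite := inferInstance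
  projective := inferInstance
  coact := sl2Coact
  coact_counit M := by
    conv_rhs => rw [sl2_eq M]
    simp [sl2Coact]
  coact_coassoc M := by
    rw [sl2_eq M]
    simp only [map_add, map_smul, sl2Coact_h, sl2Coact_e, sl2Coact_f, LinearMap.rTensor_tmul,
      LinearMap.lTensor_tmul, LinearMap.restrictScalars_apply, TensorProduct.assoc_tmul, comul_T]
  act_lie k x y := by
    have h1 : k (T (-1)) * k (T 1) = 1 := by rw [← map_mul, ← T_add]; simp
    apply Subtype.ext
    rw [contract_sl2Coact_point]
    change _ * (x.1 * y.1 - y.1 * x.1) * _ =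
      (contract sl2Coact k.toLinearMap x).1 * (contract sl2Coact k.toLinearMap y).1 -
        (contract sl2Coact k.toLinearMap y).1 * (contract sl2Coact k.toLinearMap x).1
    rw [contract_sl2Coact_point, contract_sl2Coact_point]
    have h2 : !![k (T (-1)), 0; 0, k (T 1)] * !![k (T 1), 0; 0, k (T (-1))] = 1 := by
      ext i j
      fin_cases i <;> fin_cases j <;> simp [h1, mul_comm (k (T 1))]
    generalize !![k (T (-1)), 0; 0, k (T 1)] = Q at *
    generalize !![k (T 1), 0; 0, k (T (-1))] = P at *
    have key : ∀ u v : Matrix (Fin 2) (Fin 2) ℂ, P * u * Q * (P * v * Q) = P * (u * v) * Q := by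
      intro u v
      calc P * u * Q * (P * v * Q) = P * u * (Q * P) * v * Q := by simp only [mul_assoc]
        _ = _ := by rw [h2]; simp only [mul_one, mul_assoc]
    rw [key, key, mul_sub, sub_mul]
  j := sl2j
  j_lie Z W := by
    have h : GroupFamily.atOne ⁅Z, W⁆ (T 1) = 0 := by
      change Coalgebra.counit (R := ℂ) ((⁅Z.1, W.1⁆ : Derivation ℂ SO2Ring SO2Ring) (T 1)) = 0
      rw [Derivation.commutator_apply, so2_apply_T Z, so2_apply_T W, Derivation.map_smul, Derivation.map_smul,
        so2_apply_T Z, so2_apply_T W, smul_smul, smul_smul, mul_comm, sub_self, map_zero]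
    change GroupFamily.atOne ⁅Z, W⁆ (T 1) • sl2h =
      ⁅GroupFamily.atOne Z (T 1) • sl2h, GroupFamily.atOne W (T 1) • sl2h⁆
    rw [h]; simp
  j_equivariant k Z := by
    have h : GroupFamily.atOne (GroupFamily.Ad k Z) (T 1) = GroupFamily.atOne Z (T 1) := by
      have hc : GroupFamily.conj k (T 1 : SO2Ring) = T 1 := by
        have hk : k (T 1) * k (T (-1)) = 1 := by rw [← map_mul, ← T_add]; simp
        have hi : ((WithConv.toConv ((Algebra.ofId ℂ SO2Ring).comp k))⁻¹).ofConv (T 1) =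
            algebraMap ℂ SO2Ring (k (T (-1))) := by
          change algebraMap ℂ SO2Ring (k (HopfAlgebra.antipode ℂ (T 1 : SO2Ring))) = _
          rw [antipode_T]
        have hm : ∀ f g : WithConv (SO2Ring →ₐ[ℂ] SO2Ring),
            (f * g).ofConv (T 1) = f.ofConv (T 1) * g.ofConv (T 1) := by
          intro f g
          have := AlgHom.convMul_apply f g (T 1)
          rw [comul_T] at this
          simpa using this
        rw [GroupFamily.conj, hm, hm, hi]
        change algebraMap ℂ SO2Ring (k (T 1)) * T 1 * _ = _
        rw [mul_right_comm, ← map_mul, hk, map_one, one_mul]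
      rw [GroupFamily.atOne_Ad, hc]
    change GroupFamily.atOne (GroupFamily.Ad k Z) (T 1) • sl2h = _
    rw [h, contract_sl2Coact]
    simp [sl2j, sl2h]
  lie_j Z y := by
    rw [contract_sl2Coact, so2_atOne_T_zero, so2_atOne_T_two, so2_atOne_T_neg_two]
    apply Subtype.ext
    change (GroupFamily.atOne Z (T 1) • sl2h.1) * y.1 - y.1 * (GroupFamily.atOne Z (T 1) • sl2h.1) =
      (y.1 0 0 * 0) • sl2h.1 + (y.1 0 1 * (2 * GroupFamily.atOne Z (T 1))) • sl2e.1 +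
        (y.1 1 0 * (-2 * GroupFamily.atOne Z (T 1))) • sl2f.1
    generalize GroupFamily.atOne Z (T 1) = c
    ext i j
    fin_cases i <;> fin_cases j <;>
      simp [sl2h, sl2e, sl2f, Matrix.mul_apply, Matrix.vecMul, dotProduct, Fin.sum_univ_two] <;> ring

/-- A family of Harish-Chandra pairs over the affine line `𝔸¹ = Spec ℂ[x]` is an extension of the
constant family `(𝔰𝔩₂(ℂ), SO(2, ℂ))/ℂˣ` if its restriction to `ℂˣ = Spec ℂ[x, x⁻¹]` is isomorphic to
the constant family. -/
def HarishChandraPair.IsExtension {A 𝔤 : Type*} [CommRing A] [HopfAlgebra ℂ A] [LieRing 𝔤]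
    [LieAlgebra ℂ[X] 𝔤] [Module ℂ 𝔤] [IsScalarTower ℂ ℂ[X] 𝔤]
    (P : HarishChandraPair ℂ[X] A 𝔤) : Prop :=
  Nonempty (HarishChandraPair.Iso (P.baseChange ℂ[T;T⁻¹]) (sl2Pair.baseChange ℂ[T;T⁻¹]))

end SL2

end

/-! The point is that an extension is determined by very little. Since `𝔤` is projective over
`ℂ[x]`, hence flat, it embeds in its restriction to `ℂˣ`. In the coordinates `h`, `e`, `f` it
becomes a finitely generated `ℂ[x]`-submodule of `ℂ[x, x⁻¹]³`, closed under the bracket of `𝔰𝔩₂`. It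
contains `H = (1, 0, 0)`, because `j` is defined over all of `𝔸¹` and `H` is the image of a tangent
vector of the torus (`exists_atOne_eq_one`).

As 2 is invertible, polynomials in `ad H` project `𝔤` onto its parts of weight `2` and `-2`. Each of
these is a finitely generated submodule of a localization of a principal ideal domain, so it is free
on one generator, `E` or `F`. The part of weight zero cannot exceed `ℂ[x] H`: if `s H` lies in `𝔤`,
then so does `[s H, E] = 2 s E`, which forces `s ∈ ℂ[x]`. Hence `H`, `E`, `F` is a basis and `[E, F]
= t H` for some `t ∈ ℂ[x]` (`exists_weight_basis`).

These relations are those of the matrices `(α, β; t γ, -α)`, so the group scheme of the matrices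
`(a, b; t c, d)` of determinant one, with coordinates `a, b, c, d`, has the right Lie algebra and
contains the constant torus as its diagonal (`TwistedSL2.nonempty_integration`). Where `t` vanishes
its fibre is a semidirect product of the torus with a vector group, but it is smooth for every `t`
(`TwistedSL2.smooth`). -/

/-- The coordinate ring of the group scheme of the matrices `(a, b; t c, d)` of determinant one. -/
def TwistedSL2 {R : Type*} [CommRing R] (t : R) : Type _ :=
  MvPolynomial (Fin 4) R ⧸ Ideal.span
    {(MvPolynomial.X 0 * MvPolynomial.X 3 -
      MvPolynomial.C t * (MvPolynomial.X 1 * MvPolynomial.X 2) - 1 : MvPolynomial (Fin 4) R)}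

/-! ### The Hopf algebra of the twisted `SL₂` and its smoothness -/

namespace TwistedSL2

section Ring

variable {R : Type*} [CommRing R] (t : R)

noncomputable instance : CommRing (TwistedSL2 t) := inferInstanceAs (CommRing (_ ⧸ _))

noncomputable instance : Algebra R (TwistedSL2 t) := inferInstanceAs (Algebra R (_ ⧸ _))

/-- The four matrix entries `a`, `b`, `c`, `d`. -/
noncomputable def entry (i : Fin 4) : TwistedSL2 t := Ideal.Quotient.mk _ (MvPolynomial.X i)

theorem entry_relation :
    entry t 0 * entry t 3 - algebraMap R _ t * (entry t 1 * entry t 2) = 1 := by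
  rw [← sub_eq_zero]
  exact Ideal.Quotient.eq_zero_iff_mem.mpr (Ideal.subset_span rfl)

variable {t}

/-- A point of the group scheme with values in an `R`-algebra. -/
noncomputable def lift {S : Type*} [CommRing S] [Algebra R S] (v : Fin 4 → S)
    (hv : v 0 * v 3 - algebraMap R S t * (v 1 * v 2) = 1) : TwistedSL2 t →ₐ[R] S :=
  Ideal.Quotient.liftₐ _ (MvPolynomial.aeval v) fun p hp => by
    have hle : Ideal.span {(MvPolynomial.X 0 * MvPolynomial.X 3 -
        MvPolynomial.C t * (MvPolynomial.X 1 * MvPolynomial.X 2) - 1 : MvPolynomial (Fin 4) R)} ≤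
        RingHom.ker (MvPolynomial.aeval (R := R) v) := by
      rw [Ideal.span_singleton_le_iff_mem, RingHom.mem_ker]
      simp [hv]
    exact hle hp

@[simp] theorem lift_entry {S : Type*} [CommRing S] [Algebra R S] (v : Fin 4 → S)
    (hv : v 0 * v 3 - algebraMap R S t * (v 1 * v 2) = 1) (i : Fin 4) :
    lift v hv (entry t i) = v i := by
  change MvPolynomial.aeval v (MvPolynomial.X i) = _
  simp

theorem algHom_ext {S : Type*} [Semiring S] [Algebra R S] {f g : TwistedSL2 t →ₐ[R] S}
    (h : ∀ i, f (entry t i) = g (entry t i)) : f = g := by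
  refine Ideal.Quotient.algHom_ext _ (MvPolynomial.algHom_ext fun i => ?_)
  exact h i

theorem adjoin_entry : Algebra.adjoin R (Set.range (entry t)) = ⊤ := by
  have h := congrArg (Subalgebra.map (Ideal.Quotient.mkₐ R (Ideal.span
    {(MvPolynomial.X 0 * MvPolynomial.X 3 - MvPolynomial.C t *
      (MvPolynomial.X 1 * MvPolynomial.X 2) - 1 : MvPolynomial (Fin 4) R)})))
    (MvPolynomial.adjoin_range_X (R := R) (σ := Fin 4))
  rw [AlgHom.map_adjoin, ← Set.range_comp, Algebra.map_top,
    (AlgHom.range_eq_top _).mpr (Ideal.Quotient.mkₐ_surjective R _)] at h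
  exact h

variable (t)

/-- Infinitesimal lifting: lift the four entries arbitrarily along a square-zero ideal, then correct
the determinant by rescaling one row. No condition on `t` enters. -/
theorem smooth : Algebra.Smooth R (TwistedSL2 t) where
  formallySmooth := by
    refine .of_comp_surjective fun Q _ _ I hI f => ?_
    have hf := congrArg f (entry_relation t)
    choose v hv using fun i => Ideal.Quotient.mk_surjective (f (entry t i))
    set ε := v 0 * v 3 - algebraMap R Q t * (v 1 * v 2) - 1 with hε
    have hεI : ε ∈ I := by
      rw [← Ideal.Quotient.eq_zero_iff_mem, hε]
      simp only [map_sub, map_mul, hv, map_one, Ideal.Quotient.mk_algebraMap]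
      rw [sub_eq_zero]
      simpa using hf
    have hε2 : ε * ε = 0 := by
      have : ε * ε ∈ I ^ 2 := by rw [pow_two]; exact Ideal.mul_mem_mul hεI hεI
      simpa [hI] using this
    -- The lifted determinant is `1 + ε`; scaling the first row by `1 - ε` makes it `1 - ε² = 1` and
    -- changes nothing modulo `I`.
    refine ⟨lift ![v 0 * (1 - ε), v 1 * (1 - ε), v 2, v 3] ?_, algHom_ext fun i => ?_⟩
    · simp only [Matrix.cons_val]
      linear_combination (ε - 1) * hε - hε2
    · have h0 : Ideal.Quotient.mk I ε = 0 := Ideal.Quotient.eq_zero_iff_mem.mpr hεI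
      fin_cases i <;> simp [hv, h0]
  finitePresentation :=
    Algebra.FinitePresentation.quotient (A := MvPolynomial (Fin 4) R) (Submodule.fg_span_singleton _)

/-- The comultiplication: the product of matrices. -/
noncomputable def comulHom : TwistedSL2 t →ₐ[R] TwistedSL2 t ⊗[R] TwistedSL2 t :=
  lift ![entry t 0 ⊗ₜ entry t 0 + t • entry t 1 ⊗ₜ entry t 2,
    entry t 0 ⊗ₜ entry t 1 + entry t 1 ⊗ₜ entry t 3,
    entry t 2 ⊗ₜ entry t 0 + entry t 3 ⊗ₜ entry t 2,
    t • entry t 2 ⊗ₜ entry t 1 + entry t 3 ⊗ₜ entry t 3] (by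
    let p : TwistedSL2 t →ₐ[R] TwistedSL2 t ⊗[R] TwistedSL2 t :=
      Algebra.TensorProduct.includeLeft
    let q : TwistedSL2 t →ₐ[R] TwistedSL2 t ⊗[R] TwistedSL2 t :=
      Algebra.TensorProduct.includeRight
    have h : ∀ x y : TwistedSL2 t, x ⊗ₜ[R] y = p x * q y := by simp [p, q]
    have h1 := congrArg p (entry_relation t)
    have h2 := congrArg q (entry_relation t)
    simp only [map_sub, map_mul, map_one, AlgHom.commutes] at h1 h2
    simp only [Matrix.cons_val, Algebra.smul_def, h]
    -- Multiplicativity of the determinant.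
    linear_combination h1 * q (entry t 0) * q (entry t 3) -
      h1 * algebraMap R _ t * q (entry t 1) * q (entry t 2) + h2)

/-- The counit: the identity matrix. -/
noncomputable def counitHom : TwistedSL2 t →ₐ[R] R := lift ![1, 0, 0, 1] (by simp)

/-- The antipode: the inverse matrix. -/
noncomputable def antipodeHom : TwistedSL2 t →ₐ[R] TwistedSL2 t :=
  lift ![entry t 3, -entry t 1, -entry t 2, entry t 0] (by
    simp only [Matrix.cons_val]
    linear_combination entry_relation t)

noncomputable instance : Bialgebra R (TwistedSL2 t) :=
  .ofAlgHom (comulHom t) (counitHom t)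
    (algHom_ext fun i => by
      fin_cases i <;>
        simp [comulHom, TensorProduct.add_tmul, TensorProduct.tmul_add, ← TensorProduct.smul_tmul',
          smul_add] <;> abel)
    (algHom_ext fun i => by
      fin_cases i <;> simp [comulHom, counitHom])
    (algHom_ext fun i => by
      fin_cases i <;> simp [comulHom, counitHom])

theorem comul_entry (i : Fin 4) : Coalgebra.comul (R := R) (entry t i) =
    ![entry t 0 ⊗ₜ entry t 0 + t • entry t 1 ⊗ₜ entry t 2,
      entry t 0 ⊗ₜ entry t 1 + entry t 1 ⊗ₜ entry t 3,
      entry t 2 ⊗ₜ entry t 0 + entry t 3 ⊗ₜ entry t 2,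
      t • entry t 2 ⊗ₜ entry t 1 + entry t 3 ⊗ₜ entry t 3] i := by
  change comulHom t (entry t i) = _
  rw [comulHom, lift_entry]

theorem counit_entry (i : Fin 4) :
    Coalgebra.counit (R := R) (entry t i) = (![1, 0, 0, 1] : Fin 4 → R) i := by
  change counitHom t (entry t i) = _
  rw [counitHom, lift_entry]

noncomputable instance : HopfAlgebra R (TwistedSL2 t) :=
  .ofAlgHom (antipodeHom t)
    (algHom_ext fun i => by
      have h := entry_relation t
      fin_cases i <;>
        simp [comul_entry, counit_entry, antipodeHom, Algebra.smul_def] <;>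
        first | linear_combination h | ring)
    (algHom_ext fun i => by
      have h := entry_relation t
      fin_cases i <;>
        simp [comul_entry, counit_entry, antipodeHom, Algebra.smul_def] <;>
        first | linear_combination h | ring)

theorem antipode_entry (i : Fin 4) : HopfAlgebra.antipode R (entry t i) =
    ![entry t 3, -entry t 1, -entry t 2, entry t 0] i := by
  change antipodeHom t (entry t i) = _
  rw [antipodeHom, lift_entry]

end Ring

end TwistedSL2

/-! ### Tangent vectors at the identity section -/

namespace GroupFamily

variable {R B : Type*} [CommRing R] [CommRing B] [HopfAlgebra R B]

/-- A left invariant derivation is recovered from its value at the identity by convolution, so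
identities in `Lie(G)` can be tested on tangent vectors. -/
theorem atOne_injective : Function.Injective (atOne : lie R B →ₗ[R] (B →ₗ[R] R)) := by
  intro D E h
  apply Subtype.ext
  ext b
  rw [← convRight_atOne, ← convRight_atOne, h]

theorem atOne_lie (D E : lie R B) (b : B) :
    atOne ⁅D, E⁆ b = atOne D (E.1 b) - atOne E (D.1 b) := by
  change Coalgebra.counit (R := R) ((⁅D.1, E.1⁆ : Derivation R B B) b) = _
  rw [Derivation.commutator_apply, map_sub]
  rfl

/-- Tangent vectors at the identity section that agree on generators are equal. -/
theorem IsTangentVector.eq_of_adjoin {v w : B →ₗ[R] R} (hv : IsTangentVector v)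
    (hw : IsTangentVector w) {s : Set B} (hs : Algebra.adjoin R s = ⊤)
    (h : ∀ b ∈ s, v b = w b) : v = w := by
  have one : ∀ {u : B →ₗ[R] R}, IsTangentVector u → u 1 = 0 := by
    intro u hu
    simpa using hu 1 1
  ext b
  have hb : b ∈ Algebra.adjoin R s := hs ▸ Algebra.mem_top
  induction hb using Algebra.adjoin_induction with
  | mem b hb => exact h b hb
  | algebraMap r => simp [Algebra.algebraMap_eq_smul_one, one hv, one hw]
  | add x y _ _ hx hy => simp [hx, hy]
  | mul x y _ _ hx hy => rw [hv, hw, hx, hy]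

/-- A point with values in the dual numbers that reduces to the identity section is a tangent
vector. -/
theorem isTangentVector_snd (f : B →ₐ[R] TrivSqZeroExt R R)
    (hf : ∀ b, (f b).fst = Coalgebra.counit (R := R) b) :
    IsTangentVector (TrivSqZeroExt.sndHom R R ∘ₗ f.toLinearMap) := by
  intro a b
  simp [hf, mul_comm]

/-- `conj g b = ∑ g(b₍₁₎) b₍₂₎ g(S b₍₃₎)`. -/
theorem conj_apply (g : B →ₐ[R] R) (b : B) :
    conj g b = Algebra.TensorProduct.lift ((Algebra.TensorProduct.lift
      ((Algebra.ofId R B).comp g) (AlgHom.id R B) (fun _ _ => .all _ _)).comp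
        (Bialgebra.comulAlgHom R B))
      ((Algebra.ofId R B).comp (g.comp (HopfAlgebra.antipodeAlgHom R B)))
      (fun _ _ => .all _ _) (Coalgebra.comul (R := R) b) := by
  refine (AlgHom.convMul_apply _ _ b).trans ?_
  congr 2
  ext x
  exact AlgHom.convMul_apply _ _ x

end GroupFamily

/-! ### The Lie algebra of the twisted `SL₂` -/

namespace TwistedSL2

open GroupFamily

variable {R : Type*} [CommRing R] (t : R)

/-- The point `1 + ε (α, β; t γ, -α)` with values in the dual numbers. -/
noncomputable def tangentHom (v : Fin 3 → R) : TwistedSL2 t →ₐ[R] TrivSqZeroExt R R :=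
  lift ![1 + .inr (v 0), .inr (v 1), .inr (v 2), 1 - .inr (v 0)] (by
    ext <;> simp [TrivSqZeroExt.algebraMap_eq_inl])

theorem fst_tangentHom (v : Fin 3 → R) (b : TwistedSL2 t) :
    (tangentHom t v b).fst = Coalgebra.counit (R := R) b := by
  have h : (TrivSqZeroExt.fstHom R R R).comp (tangentHom t v) =
      Bialgebra.counitAlgHom R (TwistedSL2 t) := algHom_ext fun i => by
    fin_cases i <;> simp [tangentHom, counit_entry]
  exact DFunLike.congr_fun h b

/-- Differentiate the determinant equation at the identity; the term `t b c` drops out because `b`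
and `c` both vanish there. -/
theorem atOne_entry_three (D : lie R (TwistedSL2 t)) :
    atOne D (entry t 3) = -atOne D (entry t 0) := by
  have h := congrArg (atOne D) (entry_relation t)
  have h1 : atOne D 1 = 0 := by simp
  rw [h1, map_sub, ← Algebra.smul_def, map_smul, isTangentVector_atOne D,
    isTangentVector_atOne D] at h
  simp only [counit_entry, Matrix.cons_val, smul_eq_mul] at h
  linear_combination h

theorem lie_ext {D E : lie R (TwistedSL2 t)} (h0 : atOne D (entry t 0) = atOne E (entry t 0))
    (h1 : atOne D (entry t 1) = atOne E (entry t 1))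
    (h2 : atOne D (entry t 2) = atOne E (entry t 2)) : D = E := by
  refine atOne_injective ((isTangentVector_atOne D).eq_of_adjoin (isTangentVector_atOne E)
    adjoin_entry ?_)
  rintro _ ⟨i, rfl⟩
  fin_cases i
  · exact h0
  · exact h1
  · exact h2
  · change atOne D (entry t 3) = atOne E (entry t 3)
    rw [atOne_entry_three, atOne_entry_three, h0]

/-- The Lie algebra consists of the matrices `(α, β; t γ, -α)`. -/
noncomputable def lieCoords : lie R (TwistedSL2 t) ≃ₗ[R] (Fin 3 → R) where
  toFun D := ![atOne D (entry t 0), atOne D (entry t 1), atOne D (entry t 2)]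
  map_add' D E := by ext i; fin_cases i <;> simp
  map_smul' r D := by ext i; fin_cases i <;> simp
  -- The `ε`-coefficient of the dual number point `tangentHom t v`.
  invFun v := ofTangentVector _ (isTangentVector_snd (tangentHom t v) (fst_tangentHom t v))
  left_inv D := by
    apply lie_ext <;> rw [atOne_ofTangentVector] <;> simp [tangentHom]
  right_inv v := by
    ext i
    simp only [atOne_ofTangentVector]
    fin_cases i <;> simp [tangentHom]

/-- Left invariance makes `D` the right multiplication of the generic matrix `(a, b; t c, d)` by the
tangent matrix `(α, β; t γ, -α)`, with the factor `t` removed from the lower left entry. -/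
theorem derivation_entry (D : lie R (TwistedSL2 t)) (i : Fin 4) : D.1 (entry t i) =
    ![atOne D (entry t 0) • entry t 0 + (t * atOne D (entry t 2)) • entry t 1,
      atOne D (entry t 1) • entry t 0 - atOne D (entry t 0) • entry t 1,
      atOne D (entry t 0) • entry t 2 + atOne D (entry t 2) • entry t 3,
      (t * atOne D (entry t 1)) • entry t 2 - atOne D (entry t 0) • entry t 3] i := by
  have h3 := atOne_entry_three t D
  rw [← convRight_atOne]
  generalize atOne D = v at *
  fin_cases i <;> simp [convRight, comul_entry, h3, mul_smul, sub_eq_add_neg]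

/-- The bracket of `Lie(G)` is the commutator of matrices. -/
theorem lieCoords_lie (D E : lie R (TwistedSL2 t)) : lieCoords t ⁅D, E⁆ =
    ![t * (lieCoords t D 1 * lieCoords t E 2 - lieCoords t D 2 * lieCoords t E 1),
      2 * (lieCoords t D 0 * lieCoords t E 1 - lieCoords t D 1 * lieCoords t E 0),
      -2 * (lieCoords t D 0 * lieCoords t E 2 - lieCoords t D 2 * lieCoords t E 0)] := by
  ext i
  fin_cases i <;>
    simp only [lieCoords, LinearEquiv.coe_mk, LinearMap.coe_mk, AddHom.coe_mk, atOne_lie,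
      derivation_entry, Matrix.cons_val, map_add, map_sub, map_smul, atOne_entry_three,
      smul_eq_mul, Fin.zero_eta, Fin.mk_one, Fin.reduceFinMk] <;> ring

end TwistedSL2

/-! ### The diagonal torus and the integration criterion -/

namespace TwistedSL2

open GroupFamily LaurentPolynomial

variable {R : Type*} [CommRing R] (t : R)

section Torus

variable {A : Type*} [Algebra ℂ R] [CommRing A] [HopfAlgebra ℂ A] (f : SO2Ring ≃ₐc[ℂ] A)

theorem torus_mul_inv : f (T 1) * f (T (-1)) = 1 := by
  rw [← map_mul, ← T_add]; simp

theorem torus_comul (n : ℤ) :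
    Coalgebra.comul (R := ℂ) (f (T n)) = f (T n) ⊗ₜ f (T n) := by
  rw [← CoalgHomClass.map_comp_comul_apply f (T n), comul_T]
  simp

/-- The inclusion of the constant torus as the diagonal matrices. -/
noncomputable def torusIncl : TwistedSL2 t →ₐc[R] R ⊗[ℂ] A :=
  .ofAlgHom (lift ![1 ⊗ₜ f (T 1), 0, 0, 1 ⊗ₜ f (T (-1))] (by
      simp [torus_mul_inv, Algebra.TensorProduct.one_def]))
    (algHom_ext fun i => by
      fin_cases i <;> simp [counit_entry])
    (algHom_ext fun i => by
      fin_cases i <;> simp [comul_entry, torus_comul, TensorProduct.comul_tmul])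

theorem torusIncl_entry (i : Fin 4) : torusIncl t f (entry t i) =
    (![1 ⊗ₜ f (T 1), 0, 0, 1 ⊗ₜ f (T (-1))] : Fin 4 → R ⊗[ℂ] A) i :=
  lift_entry (t := t) (![1 ⊗ₜ f (T 1), 0, 0, 1 ⊗ₜ f (T (-1))] : Fin 4 → R ⊗[ℂ] A) (by
    simp [torus_mul_inv, Algebra.TensorProduct.one_def]) i

/-- The image contains both `T` and `T⁻¹`, which generate the coordinate ring of the torus; this
makes the inclusion a closed immersion. -/
theorem torusIncl_surjective : Function.Surjective (torusIncl t f) := by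
  let S := (torusIncl t f : TwistedSL2 t →ₐ[R] R ⊗[ℂ] A).range
  have hT : ∀ n : ℤ, (1 : R) ⊗ₜ[ℂ] f (T n) ∈ S := by
    have hp : ∀ (m : ℤ) (n : ℕ), (1 : R) ⊗ₜ[ℂ] f (T m) ∈ S →
        (1 : R) ⊗ₜ[ℂ] f (T (n * m)) ∈ S := by
      intro m n h
      rw [← T_pow, map_pow]
      simpa using pow_mem h n
    intro n
    obtain ⟨k, rfl | rfl⟩ := n.eq_nat_or_neg
    · simpa using hp 1 k ⟨entry t 0, torusIncl_entry t f 0⟩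
    · simpa using hp (-1) k ⟨entry t 3, torusIncl_entry t f 3⟩
  have hA : ∀ p : SO2Ring, (1 : R) ⊗ₜ[ℂ] f p ∈ S := by
    intro p
    induction p using LaurentPolynomial.induction_on' with
    | add p q hp hq => rw [map_add, TensorProduct.tmul_add]; exact add_mem hp hq
    | C_mul_T n c =>
      have : (1 : R) ⊗ₜ[ℂ] f (C c * T n) = algebraMap ℂ R c • ((1 : R) ⊗ₜ[ℂ] f (T n)) := by
        rw [← LaurentPolynomial.smul_eq_C_mul, map_smul, algebraMap_smul, TensorProduct.tmul_smul]
      rw [this]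
      exact S.smul_mem (hT n) _
  intro x
  change x ∈ S
  induction x with
  | zero => exact zero_mem _
  | add x y hx hy => exact add_mem hx hy
  | tmul r a =>
    have h := S.smul_mem (hA (f.symm a)) r
    rwa [TensorProduct.smul_tmul', smul_eq_mul, mul_one, BialgEquiv.apply_symm_apply] at h

theorem constPoint_torusIncl (k : A →ₐ[ℂ] ℂ) (i : Fin 4) :
    ((constPoint R k).comp (torusIncl t f : TwistedSL2 t →ₐ[R] R ⊗[ℂ] A)) (entry t i) =
      (![algebraMap ℂ R (k (f (T 1))), 0, 0, algebraMap ℂ R (k (f (T (-1))))] : Fin 4 → R) i := by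
  change constPoint R k (torusIncl t f (entry t i)) = _
  rw [torusIncl_entry]
  fin_cases i <;> simp [constPoint, Algebra.ofId_apply]

/-- Conjugation by `diag(z, z⁻¹)` fixes the coordinate `a`, multiplies `b` by `z²` and `c` by `z⁻²`.
-/
theorem lieCoords_Ad (k : A →ₐ[ℂ] ℂ) (D : lie R (TwistedSL2 t)) :
    lieCoords t (Ad ((constPoint R k).comp
      (torusIncl t f : TwistedSL2 t →ₐ[R] R ⊗[ℂ] A)) D) =
      ![lieCoords t D 0, k (f (T 1)) ^ 2 • lieCoords t D 1,
        k (f (T (-1))) ^ 2 • lieCoords t D 2] := by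
  have hk : algebraMap ℂ R (k (f (T 1))) * algebraMap ℂ R (k (f (T (-1)))) = 1 := by
    rw [← map_mul, ← map_mul, torus_mul_inv, map_one, map_one]
  have hg := constPoint_torusIncl t f k
  generalize (constPoint R k).comp (torusIncl t f : TwistedSL2 t →ₐ[R] R ⊗[ℂ] A) = g at *
  have h0 : conj g (entry t 0) = entry t 0 := by
    rw [conj_apply]
    simp only [comul_entry, antipode_entry, hg, Algebra.ofId_apply, Matrix.cons_val, map_add,
      map_smul, Algebra.TensorProduct.lift_tmul, AlgHom.comp_apply, map_zero, neg_zero, mul_zero, smul_zero,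
      Bialgebra.comulAlgHom_apply, add_zero, HopfAlgebra.antipodeAlgHom_apply, AlgHom.id_apply,
      zero_mul, map_neg]
    rw [mul_right_comm, ← map_mul, hk, map_one, one_mul]
  have h1 : conj g (entry t 1) = algebraMap ℂ R (k (f (T 1))) ^ 2 • entry t 1 := by
    rw [conj_apply]
    simp [comul_entry, antipode_entry, hg, Algebra.ofId_apply, Algebra.smul_def]
    ring
  have h2 : conj g (entry t 2) = algebraMap ℂ R (k (f (T (-1)))) ^ 2 • entry t 2 := by
    rw [conj_apply]
    simp [comul_entry, antipode_entry, hg, Algebra.ofId_apply, Algebra.smul_def]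
    ring
  ext i
  fin_cases i <;>
    simp only [lieCoords, LinearEquiv.coe_mk, LinearMap.coe_mk, AddHom.coe_mk, atOne_Ad, h0, h1,
      h2, map_smul, Matrix.cons_val, Fin.zero_eta, Fin.mk_one, Fin.reduceFinMk] <;>
    rw [← algebraMap_smul R (_ ^ 2 : ℂ), map_pow]

theorem lieCoords_differential (Z : lie ℂ A) :
    lieCoords t (differential (torusIncl t f) (constSection R Z)) =
      ![algebraMap ℂ R (atOne Z (f (T 1))), 0, 0] := by
  ext i
  fin_cases i <;>
    simp only [lieCoords, LinearEquiv.coe_mk, LinearMap.coe_mk, AddHom.coe_mk,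
      atOne_differential, torusIncl_entry, Matrix.cons_val, Fin.zero_eta, Fin.mk_one,
      Fin.reduceFinMk, map_zero, atOne_constSection, Algebra.smul_def, mul_one]

variable {𝔤 : Type*} [LieRing 𝔤] [LieAlgebra R 𝔤] [Module ℂ 𝔤] [IsScalarTower ℂ R 𝔤]

/-- A pair with the group `SO(2, ℂ)` that has a basis `H`, `E`, `F` of weight vectors with
`[E, F] = t H` is integrated by the group scheme of the matrices `(a, b; t c, d)`. -/
theorem nonempty_integration (P : HarishChandraPair R A 𝔤) (b : Module.Basis (Fin 3) R 𝔤)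
    (h01 : ⁅b 0, b 1⁆ = (2 : R) • b 1) (h02 : ⁅b 0, b 2⁆ = (-2 : R) • b 2)
    (h12 : ⁅b 1, b 2⁆ = t • b 0) (hj : ∀ Z, P.j Z = atOne Z (f (T 1)) • b 0)
    (act0 : ∀ k, P.act k (b 0) = b 0) (act1 : ∀ k, P.act k (b 1) = k (f (T 1)) ^ 2 • b 1)
    (act2 : ∀ k, P.act k (b 2) = k (f (T (-1))) ^ 2 • b 2) :
    Nonempty (P.Integration (TwistedSL2 t)) := by
  have hφ : ∀ D, ((lieCoords t).trans b.equivFun.symm) D =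
      lieCoords t D 0 • b 0 + lieCoords t D 1 • b 1 + lieCoords t D 2 • b 2 := by
    intro D
    simp [Module.Basis.equivFun_symm_apply, Fin.sum_univ_three]
  have h10 : ⁅b 1, b 0⁆ = (-2 : R) • b 1 := by rw [← lie_skew, h01, neg_smul]
  have h20 : ⁅b 2, b 0⁆ = (2 : R) • b 2 := by rw [← lie_skew, h02, neg_smul, neg_neg]
  have h21 : ⁅b 2, b 1⁆ = (-t) • b 0 := by rw [← lie_skew, h12, neg_smul]
  exact ⟨{
    smooth := smooth t
    incl := torusIncl t f
    incl_surjective := torusIncl_surjective t f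
    lieEquiv :=
      { (lieCoords t).trans b.equivFun.symm with
        map_lie' := by
          intro D E
          change ((lieCoords t).trans b.equivFun.symm) ⁅D, E⁆ =
            ⁅((lieCoords t).trans b.equivFun.symm) D, ((lieCoords t).trans b.equivFun.symm) E⁆
          -- Both brackets are bilinear with the same structure constants.
          rw [hφ, hφ, hφ, lieCoords_lie]
          simp only [lie_add, add_lie, smul_lie, lie_smul, lie_self, h01, h02, h12, h10, h20, h21,
            Matrix.cons_val]
          module }
    lieEquiv_differential := by
      intro Z
      change ((lieCoords t).trans b.equivFun.symm) _ = _
      rw [hφ, lieCoords_differential, hj]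
      simp
    lieEquiv_Ad := by
      intro k D
      change ((lieCoords t).trans b.equivFun.symm) _ =
        P.act k (((lieCoords t).trans b.equivFun.symm) D)
      rw [hφ, hφ, lieCoords_Ad]
      simp only [map_add, map_smul, act0, act1, act2, Matrix.cons_val]
      simp only [← algebraMap_smul R (_ : ℂ), smul_smul, smul_eq_mul, mul_comm] }⟩

end Torus

end TwistedSL2

/-! ### Lattices over a principal ideal ring -/

/-- Finitely generated submodules of a localization of a principal ideal ring are cyclic. -/
theorem Submodule.FG.exists_eq_span_singleton_of_isLocalization {R S : Type*} [CommRing R]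
    [IsPrincipalIdealRing R] [CommRing S] [Algebra R S] (M : Submonoid R) [IsLocalization M S]
    {N : Submodule R S} (hN : N.FG) : ∃ s ∈ N, ∀ n ∈ N, ∃ r : R, n = algebraMap R S r * s := by
  obtain ⟨G, rfl⟩ := hN
  obtain ⟨b, hb⟩ := IsLocalization.exist_integer_multiples_of_finset M G
  -- The common denominator `b` carries the submodule into the image of `R`; `J` is the ideal of
  -- numerators, and a generator of it, divided by `b`, generates the submodule.
  let J : Ideal R := ((Submodule.span R (G : Set S)).map (LinearMap.lsmul R S (b : R))).comap
    (Algebra.linearMap R S)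
  have hJ : ∀ n ∈ Submodule.span R (G : Set S), ∃ r ∈ J, algebraMap R S r = (b : R) • n := by
    intro n hn
    have h : (b : R) • n ∈ LinearMap.range (Algebra.linearMap R S) := by
      have : Submodule.span R (G : Set S) ≤
          (LinearMap.range (Algebra.linearMap R S)).comap (LinearMap.lsmul R S (b : R)) :=
        Submodule.span_le.mpr fun a ha => hb a ha
      exact this hn
    obtain ⟨r, hr⟩ := h
    exact ⟨r, ⟨n, hn, hr.symm⟩, hr⟩
  obtain ⟨n₀, hn₀, hg⟩ : Submodule.IsPrincipal.generator J ∈ J :=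
    Submodule.IsPrincipal.generator_mem J
  refine ⟨n₀, hn₀, fun n hn => ?_⟩
  obtain ⟨r, hr, h⟩ := hJ n hn
  obtain ⟨q, rfl⟩ := (Submodule.IsPrincipal.mem_iff_eq_smul_generator J).mp hr
  refine ⟨q, (IsLocalization.map_units S b).mul_left_cancel ?_⟩
  change (b : R) • n₀ = algebraMap R S _ at hg
  rw [Algebra.smul_def] at hg
  rw [smul_eq_mul, map_mul, ← hg, Algebra.smul_def] at h
  rw [← h]
  exact mul_left_comm _ _ _

/-- A lattice in `𝔰𝔩₂` over a localization of a principal ideal domain that contains `H` has a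
basis of weight vectors `H`, `E`, `F`. -/
theorem exists_weight_basis {R S 𝔤 : Type*} [CommRing R] [IsPrincipalIdealRing R]
    [CommRing S] [IsDomain S] [Algebra R S] [FaithfulSMul R S] (M : Submonoid R)
    [IsLocalization M S]
    [LieRing 𝔤] [LieAlgebra R 𝔤] [Module.Finite R 𝔤] (u : R) (hu : u * 2 = 1)
    (φ : 𝔤 →ₗ[R] Fin 3 → S) (hφ : Function.Injective φ)
    (hlie : ∀ x y, φ ⁅x, y⁆ = ![φ x 1 * φ y 2 - φ x 2 * φ y 1,
      2 * (φ x 0 * φ y 1 - φ x 1 * φ y 0), -2 * (φ x 0 * φ y 2 - φ x 2 * φ y 0)])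
    (H : 𝔤) (hH : φ H = ![1, 0, 0]) (h1 : ∃ y, φ y 1 ≠ 0) (h2 : ∃ y, φ y 2 ≠ 0) :
    ∃ (b : Module.Basis (Fin 3) R 𝔤) (t : R) (p q : S), b 0 = H ∧ φ (b 1) = ![0, p, 0] ∧
      φ (b 2) = ![0, 0, q] ∧ ⁅b 0, b 1⁆ = (2 : R) • b 1 ∧ ⁅b 0, b 2⁆ = (-2 : R) • b 2 ∧
      ⁅b 1, b 2⁆ = t • b 0 := by
  have hu' : algebraMap R S u * 2 = 1 := by
    rw [← map_ofNat (algebraMap R S) 2, ← map_mul, hu, map_one]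
  have h2R : algebraMap R S 2 = 2 := map_ofNat _ 2
  -- The `i`-th coordinates of the lattice form a finitely generated submodule of `S`, hence a
  -- cyclic one.
  have gen : ∀ i, (∃ y, φ y i ≠ 0) → ∃ y₀, φ y₀ i ≠ 0 ∧
      ∀ y, ∃ r, φ y i = algebraMap R S r * φ y₀ i := by
    intro i hi
    obtain ⟨_, ⟨y₀, rfl⟩, hs⟩ :=
      Submodule.FG.exists_eq_span_singleton_of_isLocalization M
        (N := LinearMap.range (LinearMap.proj (R := R) i ∘ₗ φ))
        (Module.Finite.iff_fg.mp inferInstance)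
    refine ⟨y₀, fun h0 => ?_, fun y => hs _ ⟨y, rfl⟩⟩
    obtain ⟨y, hy⟩ := hi
    obtain ⟨r, hr⟩ := hs _ ⟨y, rfl⟩
    simp only [LinearMap.comp_apply, LinearMap.proj_apply] at hr
    exact hy (by rw [hr, h0, mul_zero])
  -- On weights `0, 2, -2` the operator `(ad H)² + 2 ad H` is `0, 8, 0`, and `u ^ 3` is `1/8`. The
  -- opposite sign isolates weight `-2`.
  have proj1 : ∀ y, ∃ y', φ y' = ![0, φ y 1, 0] := by
    intro y
    refine ⟨(u ^ 3) • (⁅H, ⁅H, y⁆⁆ + (2 : R) • ⁅H, y⁆), ?_⟩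
    rw [map_smul, map_add, map_smul, hlie, hlie, hH]
    ext i
    fin_cases i <;> simp only [Pi.smul_apply, Pi.add_apply] <;> simp only [Matrix.cons_val,
      Algebra.smul_def, map_pow, h2R, Fin.zero_eta, Fin.mk_one, Fin.reduceFinMk]
    · ring
    · linear_combination φ y 1 * ((algebraMap R S u * 2) ^ 2 + algebraMap R S u * 2 + 1) * hu'
    · ring
  have proj2 : ∀ y, ∃ y', φ y' = ![0, 0, φ y 2] := by
    intro y
    refine ⟨(u ^ 3) • (⁅H, ⁅H, y⁆⁆ - (2 : R) • ⁅H, y⁆), ?_⟩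
    rw [map_smul, map_sub, map_smul, hlie, hlie, hH]
    ext i
    fin_cases i <;> simp only [Pi.smul_apply, Pi.sub_apply] <;> simp only [Matrix.cons_val,
      Algebra.smul_def, map_pow, h2R, Fin.zero_eta, Fin.mk_one, Fin.reduceFinMk]
    · ring
    · ring
    linear_combination φ y 2 * ((algebraMap R S u * 2) ^ 2 + algebraMap R S u * 2 + 1) * hu'
  obtain ⟨y₁, hp0, hp⟩ := gen 1 h1
  obtain ⟨y₂, hq0, hq⟩ := gen 2 h2
  obtain ⟨E, hE⟩ := proj1 y₁
  obtain ⟨F, hF⟩ := proj2 y₂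
  generalize φ y₁ 1 = p at *
  generalize φ y₂ 2 = q at *
  -- Bracketing with `E` sends `x H` to `2 x E`, whose coordinate `2 x p` must be an `R`-multiple of
  -- the generator `p`. So `2 x`, and then `x`, comes from `R`.
  have zero_weight : ∀ z x, φ z = ![x, 0, 0] → ∃ r : R, z = r • H := by
    intro z x hz
    obtain ⟨r, hr⟩ := hp ⁅z, E⁆
    have hx : x = algebraMap R S (u * r) := by
      rw [hlie, hz, hE] at hr
      simp only [Matrix.cons_val] at hr
      apply mul_right_cancel₀ hp0
      rw [map_mul]
      linear_combination algebraMap R S u * hr - x * p * hu'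
    refine ⟨u * r, hφ ?_⟩
    rw [map_smul, hz, hH, hx]
    ext i
    fin_cases i <;> simp [Algebra.smul_def]
  -- Subtracting the multiples of `E` and `F` with the right coordinates leaves an element of weight
  -- zero.
  have hspan : ∀ y, ∃ α β γ : R, y = α • H + β • E + γ • F := by
    intro y
    obtain ⟨β, hβ⟩ := hp y
    obtain ⟨γ, hγ⟩ := hq y
    obtain ⟨α, hα⟩ := zero_weight (y - β • E - γ • F) (φ y 0) (by
      rw [map_sub, map_sub, map_smul, map_smul, hE, hF]
      ext i
      fin_cases i <;> simp [Algebra.smul_def, hβ, hγ])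
    exact ⟨α, β, γ, by rw [← hα]; abel⟩
  have hli : LinearIndependent R ![H, E, F] := by
    rw [Fintype.linearIndependent_iff]
    intro g hg
    rw [Fin.sum_univ_three] at hg
    have h := congrArg φ hg
    simp only [Matrix.cons_val, map_add, map_smul, hH, hE, hF, map_zero] at h
    have inj := FaithfulSMul.algebraMap_injective R S
    intro i
    have hi := congrFun h i
    apply inj
    fin_cases i <;> simpa [Algebra.smul_def, hp0, hq0] using hi
  let b := Module.Basis.mk hli (fun y _ => by
    obtain ⟨α, β, γ, rfl⟩ := hspan y
    refine add_mem (add_mem ?_ ?_) ?_ <;> refine Submodule.smul_mem _ _ (Submodule.subset_span ?_)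
    exacts [⟨0, rfl⟩, ⟨1, rfl⟩, ⟨2, rfl⟩])
  have b0 : b 0 = H := Module.Basis.mk_apply ..
  have b1 : b 1 = E := Module.Basis.mk_apply ..
  have b2 : b 2 = F := Module.Basis.mk_apply ..
  -- `[E, F]` has weight zero and coordinate `p q`, so `t` is `p q`, which thereby lies in `R`.
  obtain ⟨t, ht⟩ := zero_weight ⁅E, F⁆ (p * q) (by rw [hlie, hE, hF]; simp)
  refine ⟨b, t, p, q, b0, b1 ▸ hE, b2 ▸ hF, ?_, ?_, by rw [b0, b1, b2, ht]⟩
  · rw [b0, b1]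
    apply hφ
    rw [hlie, map_smul, hH, hE]
    ext i
    fin_cases i <;> simp [Algebra.smul_def, h2R]
  · rw [b0, b2]
    apply hφ
    rw [hlie, map_smul, hH, hF]
    ext i
    fin_cases i <;> simp [Algebra.smul_def, h2R]

/-! ### Coordinates on the constant family -/

section Coordinates

open LaurentPolynomial GroupFamily

variable {S : Type*} [CommRing S] [Algebra ℂ S]

/-- The coordinates with respect to `sl2h`, `sl2e`, `sl2f`. -/
def sl2Coord : sl2 →ₗ[ℂ] Fin 3 → ℂ where
  toFun M := ![M.1 0 0, M.1 0 1, M.1 1 0]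
  map_add' M N := by ext i; fin_cases i <;> simp
  map_smul' c M := by ext i; fin_cases i <;> simp

variable (S) in
/-- The coordinates on the base change of `𝔰𝔩₂(ℂ)`. -/
noncomputable def sl2CoordBaseChange : S ⊗[ℂ] sl2 →ₗ[S] Fin 3 → S :=
  LinearMap.pi fun i => (TensorProduct.AlgebraTensorModule.rid ℂ S S).toLinearMap ∘ₗ
    (LinearMap.proj i ∘ₗ sl2Coord).baseChange S

theorem sl2CoordBaseChange_tmul (s : S) (M : sl2) (i : Fin 3) :
    sl2CoordBaseChange S (s ⊗ₜ M) i = sl2Coord M i • s := by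
  simp [sl2CoordBaseChange]

theorem sl2CoordBaseChange_injective : Function.Injective (sl2CoordBaseChange S) := by
  have h : ∀ w, w = sl2CoordBaseChange S w 0 • (1 : S) ⊗ₜ[ℂ] sl2h +
      sl2CoordBaseChange S w 1 • (1 : S) ⊗ₜ[ℂ] sl2e +
      sl2CoordBaseChange S w 2 • (1 : S) ⊗ₜ[ℂ] sl2f := by
    intro w
    induction w with
    | zero => simp
    | add x y hx hy =>
      simp only [map_add, Pi.add_apply, add_smul]
      nth_rewrite 1 [hx, hy]
      abel
    | tmul s M =>
      nth_rewrite 1 [sl2_eq M]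
      simp [sl2CoordBaseChange_tmul, sl2Coord, TensorProduct.tmul_add, TensorProduct.smul_tmul']
  intro x y hxy
  rw [h x, h y, hxy]

theorem sl2CoordBaseChange_lie (x y : S ⊗[ℂ] sl2) : sl2CoordBaseChange S ⁅x, y⁆ =
    ![sl2CoordBaseChange S x 1 * sl2CoordBaseChange S y 2 -
        sl2CoordBaseChange S x 2 * sl2CoordBaseChange S y 1,
      2 * (sl2CoordBaseChange S x 0 * sl2CoordBaseChange S y 1 -
        sl2CoordBaseChange S x 1 * sl2CoordBaseChange S y 0),
      -2 * (sl2CoordBaseChange S x 0 * sl2CoordBaseChange S y 2 -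
        sl2CoordBaseChange S x 2 * sl2CoordBaseChange S y 0)] := by
  have zero_left : ∀ y : S ⊗[ℂ] sl2, ⁅(0 : S ⊗[ℂ] sl2), y⁆ = 0 := fun y => zero_lie y
  have zero_right : ∀ x : S ⊗[ℂ] sl2, ⁅x, (0 : S ⊗[ℂ] sl2)⁆ = 0 := fun x => lie_zero x
  have add_left : ∀ x₁ x₂ y : S ⊗[ℂ] sl2, ⁅x₁ + x₂, y⁆ = ⁅x₁, y⁆ + ⁅x₂, y⁆ :=
    LieRing.add_lie
  have add_right : ∀ x y₁ y₂ : S ⊗[ℂ] sl2, ⁅x, y₁ + y₂⁆ = ⁅x, y₁⁆ + ⁅x, y₂⁆ :=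
    LieRing.lie_add
  induction x with
  | zero => rw [zero_left]; ext i; fin_cases i <;> simp
  | add x₁ x₂ h₁ h₂ =>
    rw [add_left, map_add, h₁, h₂, map_add]
    ext i
    fin_cases i <;> simp <;> ring
  | tmul s M =>
    induction y with
    | zero => rw [zero_right]; ext i; fin_cases i <;> simp
    | add y₁ y₂ h₁ h₂ =>
      rw [add_right, map_add, h₁, h₂, map_add]
      ext i
      fin_cases i <;> simp <;> ring
    | tmul r N =>
      have hM : M.1 1 1 = -M.1 0 0 := by linear_combination sl2_trace M
      have hN : N.1 1 1 = -N.1 0 0 := by linear_combination sl2_trace N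
      have hMN : sl2Coord ⁅M, N⁆ = ![M.1 0 1 * N.1 1 0 - M.1 1 0 * N.1 0 1,
          2 * (M.1 0 0 * N.1 0 1 - M.1 0 1 * N.1 0 0),
          -2 * (M.1 0 0 * N.1 1 0 - M.1 1 0 * N.1 0 0)] := by
        ext i
        fin_cases i <;>
          simp [sl2Coord, LieSubalgebra.coe_bracket, Ring.lie_def, Matrix.mul_apply,
            Fin.sum_univ_two, hM, hN] <;> ring
      have h2 : algebraMap ℂ S 2 = 2 := map_ofNat _ 2
      rw [LieAlgebra.ExtendScalars.bracket_tmul]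
      ext i
      rw [sl2CoordBaseChange_tmul, hMN]
      fin_cases i <;>
        simp [sl2CoordBaseChange_tmul, sl2Coord, Algebra.smul_def, h2] <;> ring

theorem sl2CoordBaseChange_act (k : SO2Ring →ₐ[ℂ] ℂ) (x : S ⊗[ℂ] sl2) :
    sl2CoordBaseChange S ((sl2Pair.baseChange S).act k x) =
      ![sl2CoordBaseChange S x 0, k (T 2) • sl2CoordBaseChange S x 1,
        k (T (-2)) • sl2CoordBaseChange S x 2] := by
  induction x with
  | zero => ext i; fin_cases i <;> simp
  | add x y hx hy => ext i; rw [map_add, map_add, hx, hy]; fin_cases i <;> simp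
  | tmul s M =>
    have h : (sl2Pair.baseChange S).act k (s ⊗ₜ M) = s ⊗ₜ contract sl2Coact k.toLinearMap M :=
      HarishChandraPair.contract_baseChangeCoact S sl2Coact k.toLinearMap s M
    rw [h, contract_sl2Coact]
    ext i
    rw [sl2CoordBaseChange_tmul]
    fin_cases i <;>
      simp [sl2CoordBaseChange_tmul, sl2Coord, sl2h, sl2e, sl2f, mul_smul, smul_comm (M.1 _ _)]

theorem sl2CoordBaseChange_j (Z : lie ℂ SO2Ring) :
    sl2CoordBaseChange S ((sl2Pair.baseChange S).j Z) =
      ![algebraMap ℂ S (atOne Z (T 1)), 0, 0] := by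
  have h : (sl2Pair.baseChange S).j Z = (1 : S) ⊗ₜ (atOne Z (T 1) • sl2h) := rfl
  rw [h]
  ext i
  rw [sl2CoordBaseChange_tmul]
  fin_cases i <;> simp [sl2Coord, sl2h, Algebra.smul_def]

/-- The homomorphism `T ↦ 1 + ε` to the dual numbers. -/
noncomputable def so2TangentHom : SO2Ring →ₐ[ℂ] TrivSqZeroExt ℂ ℂ :=
  AddMonoidAlgebra.lift ℂ (TrivSqZeroExt ℂ ℂ) ℤ
    -- `(1 + ε)ⁿ = 1 + n ε`.
    { toFun := fun n => 1 + .inr (n.toAdd : ℂ)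
      map_one' := by simp
      map_mul' := fun m n => by
        ext <;> simp [add_comm] }

theorem so2TangentHom_T (n : ℤ) : so2TangentHom (T n) = 1 + .inr (n : ℂ) := by
  exact (AddMonoidAlgebra.lift_single _ _ _).trans (one_smul ℂ _)

variable {A : Type*} [CommRing A] [HopfAlgebra ℂ A]

/-- Transport `T ↦ 1 + ε` along `f`. The resulting `Z` is the element of `Lie(K)` whose image under
`j` will be `H`. -/
theorem exists_atOne_eq_one (f : SO2Ring ≃ₐc[ℂ] A) : ∃ Z : lie ℂ A, atOne Z (f (T 1)) = 1 := by
  have h1 : ∀ p : SO2Ring, (so2TangentHom p).fst = Coalgebra.counit (R := ℂ) p := by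
    intro p
    induction p using LaurentPolynomial.induction_on' with
    | add p q hp hq => simp [hp, hq]
    | C_mul_T n c =>
      rw [← LaurentPolynomial.smul_eq_C_mul, map_smul, map_smul, counit_T, so2TangentHom_T]
      simp
  let g : A →ₐ[ℂ] TrivSqZeroExt ℂ ℂ :=
    so2TangentHom.comp ((f.symm : A →ₐc[ℂ] SO2Ring) : A →ₐ[ℂ] SO2Ring)
  have hg : ∀ a, g a = so2TangentHom (f.symm a) := fun a => rfl
  refine ⟨ofTangentVector _ (isTangentVector_snd g fun a => ?_), ?_⟩
  · rw [hg, h1, CoalgHomClass.counit_comp_apply f.symm a]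
  · rw [atOne_ofTangentVector]
    simp [hg, so2TangentHom_T]

end Coordinates

/-! ### An extension as a lattice in the constant family over `ℂˣ` -/

section Extension

open LaurentPolynomial GroupFamily

/-- Tensor the injection `ℂ[x] → ℂ[x, x⁻¹]` with a flat module: a section is determined by its
restriction to `ℂˣ`. -/
theorem LaurentPolynomial.mk_one_injective (N : Type*) [AddCommGroup N] [Module ℂ[X] N]
    [Module.Flat ℂ[X] N] : Function.Injective (TensorProduct.mk ℂ[X] ℂ[T;T⁻¹] N 1) := by
  have h := Module.Flat.rTensor_preserves_injective_linearMap (M := N)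
    (Algebra.linearMap ℂ[X] ℂ[T;T⁻¹]) Polynomial.toLaurent_injective
  intro x y hxy
  have : (1 : ℂ[X]) ⊗ₜ[ℂ[X]] x = 1 ⊗ₜ y := h (by simpa using hxy)
  simpa using congrArg (TensorProduct.lid ℂ[X] N) this

variable {A 𝔤 : Type*} [CommRing A] [HopfAlgebra ℂ A] [LieRing 𝔤] [LieAlgebra ℂ[X] 𝔤]
  [Module ℂ 𝔤] [IsScalarTower ℂ ℂ[X] 𝔤]

variable {P : HarishChandraPair ℂ[X] A 𝔤}
  (I : HarishChandraPair.Iso (P.baseChange ℂ[T;T⁻¹]) (sl2Pair.baseChange ℂ[T;T⁻¹]))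

/-- The coordinates over `ℂˣ` of the sections of an extension. -/
noncomputable def extensionCoord : 𝔤 →ₗ[ℂ[X]] Fin 3 → ℂ[T;T⁻¹] :=
  (sl2CoordBaseChange ℂ[T;T⁻¹] ∘ₗ
    (I.lieEquiv : ℂ[T;T⁻¹] ⊗[ℂ[X]] 𝔤 →ₗ[ℂ[T;T⁻¹]] ℂ[T;T⁻¹] ⊗[ℂ] sl2)).restrictScalars ℂ[X] ∘ₗ
      TensorProduct.mk ℂ[X] ℂ[T;T⁻¹] 𝔤 1

theorem extensionCoord_apply (x : 𝔤) :
    extensionCoord I x = sl2CoordBaseChange ℂ[T;T⁻¹] (I.lieEquiv (1 ⊗ₜ x)) := rfl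

/-- Every identity in `𝔤` can therefore be checked in coordinates over `ℂˣ`, where bracket, action
and `j` are explicit. -/
theorem extensionCoord_injective : Function.Injective (extensionCoord I) := by
  have := P.projective
  exact sl2CoordBaseChange_injective.comp
    (I.lieEquiv.injective.comp (LaurentPolynomial.mk_one_injective 𝔤))

theorem extensionCoord_lie (x y : 𝔤) : extensionCoord I ⁅x, y⁆ =
    ![extensionCoord I x 1 * extensionCoord I y 2 - extensionCoord I x 2 * extensionCoord I y 1,
      2 * (extensionCoord I x 0 * extensionCoord I y 1 -
        extensionCoord I x 1 * extensionCoord I y 0),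
      -2 * (extensionCoord I x 0 * extensionCoord I y 2 -
        extensionCoord I x 2 * extensionCoord I y 0)] := by
  have h : (1 : ℂ[T;T⁻¹]) ⊗ₜ[ℂ[X]] ⁅x, y⁆ = ⁅(1 : ℂ[T;T⁻¹]) ⊗ₜ[ℂ[X]] x, 1 ⊗ₜ y⁆ := by simp
  rw [extensionCoord_apply, h, LieEquiv.map_lie, sl2CoordBaseChange_lie]
  rfl

theorem extensionCoord_act (k : A →ₐ[ℂ] ℂ) (x : 𝔤) : extensionCoord I (P.act k x) =
    ![extensionCoord I x 0, k (I.groupEquiv (T 2)) • extensionCoord I x 1,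
      k (I.groupEquiv (T (-2))) • extensionCoord I x 2] := by
  have h : (P.baseChange ℂ[T;T⁻¹]).act k (1 ⊗ₜ x) = 1 ⊗ₜ P.act k x :=
    HarishChandraPair.contract_baseChangeCoact ℂ[T;T⁻¹] P.coact k.toLinearMap 1 x
  rw [extensionCoord_apply, ← h, I.equivariant, sl2CoordBaseChange_act]
  rfl

theorem extensionCoord_j (Z : lie ℂ A) : extensionCoord I (P.j Z) =
    ![algebraMap ℂ ℂ[T;T⁻¹] (atOne Z (I.groupEquiv (T 1))), 0, 0] := by
  have h : (P.baseChange ℂ[T;T⁻¹]).j Z = (1 : ℂ[T;T⁻¹]) ⊗ₜ P.j Z := rfl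
  rw [extensionCoord_apply, ← h, I.compatible, sl2CoordBaseChange_j, atOne_differential]
  rfl

/-- The sections of `𝔤` span its restriction to `ℂˣ`, so a coordinate vanishing on all of them would
vanish on the whole constant family. -/
theorem exists_extensionCoord_ne_zero (i : Fin 3) : ∃ y, extensionCoord I y i ≠ 0 := by
  by_contra! h0
  have h : ∀ w, sl2CoordBaseChange ℂ[T;T⁻¹] (I.lieEquiv w) i = 0 := by
    intro w
    induction w with
    | zero => simp
    | add x y hx hy => simp [hx, hy]
    | tmul r y =>
      have hr : r ⊗ₜ[ℂ[X]] y = r • ((1 : ℂ[T;T⁻¹]) ⊗ₜ[ℂ[X]] y) := by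
        rw [TensorProduct.smul_tmul', smul_eq_mul, mul_one]
      rw [hr, map_smul, map_smul, Pi.smul_apply, ← extensionCoord_apply, h0, smul_zero]
  have h1 := h (I.lieEquiv.symm (1 ⊗ₜ (![sl2h, sl2e, sl2f] i)))
  rw [LieEquiv.apply_symm_apply, sl2CoordBaseChange_tmul] at h1
  fin_cases i <;> simp [sl2Coord, sl2h, sl2e, sl2f] at h1

end Extension

theorem mainTheorem11 {A : Type*} {𝔤 : Type*} [CommRing A] [HopfAlgebra ℂ A]
    [LieRing 𝔤] [LieAlgebra ℂ[X] 𝔤] [Module ℂ 𝔤] [IsScalarTower ℂ ℂ[X] 𝔤]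
    (P : HarishChandraPair ℂ[X] A 𝔤) (hP : P.IsExtension) :
    ∃ (B : Type) (_ : CommRing B) (_ : HopfAlgebra ℂ[X] B), Nonempty (P.Integration B) := by
  obtain ⟨I⟩ := hP
  have := P.finite
  have : FaithfulSMul ℂ[X] ℂ[T;T⁻¹] :=
    (faithfulSMul_iff_algebraMap_injective _ _).mpr Polynomial.toLaurent_injective
  have hinj := extensionCoord_injective I
  obtain ⟨Z₀, hZ₀⟩ := exists_atOne_eq_one I.groupEquiv
  have hu : (Polynomial.C (2⁻¹ : ℂ) : ℂ[X]) * 2 = 1 := by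
    rw [← Polynomial.C_ofNat, ← Polynomial.C_mul]
    simp
  have hH : extensionCoord I (P.j Z₀) = ![1, 0, 0] := by
    rw [extensionCoord_j, hZ₀, map_one]
  have hsmul : ∀ (c : ℂ) (x : 𝔤), extensionCoord I (c • x) = c • extensionCoord I x := by
    intro c x
    rw [← algebraMap_smul ℂ[X] c x, map_smul, algebraMap_smul]
  -- `ℂ[x, x⁻¹]` is the localization of `ℂ[x]` at the powers of `x`, and the constant `1/2` plays
  -- the role of `u`.
  obtain ⟨b, t, p, q, h0, h1, h2, h01, h02, h12⟩ := exists_weight_basis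
    (Submonoid.powers (Polynomial.X : ℂ[X])) _ hu (extensionCoord I) hinj
    (extensionCoord_lie I) (P.j Z₀) hH (exists_extensionCoord_ne_zero I 1)
    (exists_extensionCoord_ne_zero I 2)
  -- The basis vectors lie on the coordinate axes, so the torus scales them by the characters `1`,
  -- `T²`, `T⁻²`; `hinj` brings this back to `𝔤`.
  refine ⟨TwistedSL2 t, inferInstance, inferInstance,
    TwistedSL2.nonempty_integration t I.groupEquiv P b h01 h02 h12 (fun Z => hinj ?_)
      (fun k => hinj ?_) (fun k => hinj ?_) fun k => hinj ?_⟩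
  · rw [hsmul, h0, hH, extensionCoord_j]
    ext i : 1
    fin_cases i <;> simp [Algebra.smul_def]
  · rw [h0, extensionCoord_act, hH]
    simp
  · rw [hsmul, extensionCoord_act, h1, ← map_pow, ← map_pow, LaurentPolynomial.T_pow]
    ext i : 1
    fin_cases i <;> simp
  · rw [hsmul, extensionCoord_act, h2, ← map_pow, ← map_pow, LaurentPolynomial.T_pow]
    ext i : 1
    fin_cases i <;> simp
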